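/- **Setting.** Let $K\ge 1$, $0<a<1$, $\varepsilon>0$, and $\gamma_1,\dots,\gamma_K>0$. Let $(\theta_i,\boldsymbol\xi_i)$, $i\ge 1$, be i.i.d. with $\theta_i\sim\mathrm{Bernoulli}(a)$ such that $\boldsymbol\xi_i$ is uniform on $[0,1]^K$ given $\theta_i=0$ (the $i$-th null hypothesis is true) and has density $g$ on $[0,1]^K$ given $\theta_i=1$ (it is false). Assume that $g\in C([0,1]^K)$, that $g(\mathbf x)<g(\mathbf 0)$ for all $\mathbf x\neq\mathbf 0$, and that $$g(\mathbf x)=g(\mathbf 0)\Bigl(1-\sum_{k}\gamma_k x_k^{\varepsilon}+r(\mathbf x)\Bigr),\qquad r(\mathbf x)=o(|\mathbf x|^{\varepsilon})\ \text{ as } |\mathbf x|\to 0 .$$ Put $$\alpha_*=\frac1{1-a+a\,g(\mathbf 0)},\qquad V_\varepsilon=\ell\Bigl(\bigl\{\mathbf x\in[0,1]^K:\textstyle\sum_k x_k^\varepsilon\le 1\bigr\}\Bigr),$$ where $\ell$ is Lebesgue measure, and for $\boldsymbol\nu\in(0,\infty)^K$ put $$\bar\nu=(\nu_1\cdots\nu_K)^{1/K},\quad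 \Gamma_u(\boldsymbol\nu)=\Bigl\{\mathbf x\in[0,1]^K:\textstyle\sum_k\nu_kx_k^\varepsilon\le u\Bigr\},\quad h(u;\boldsymbol\nu)=\ell(\Gamma_u(\boldsymbol\nu)).$$ Given $n$ nulls and $\alpha\in(0,1)$, consider the procedure that applies the Benjamini–Hochberg procedure to $s_i=h\bigl(\sum_k\nu_k\xi_{ik}^\varepsilon;\boldsymbol\nu\bigr)$, $i=1,\dots,n$; i.e. it rejects the $i$-th null if and only if $s_i\le\tau$, where $$\tau=\sup\{t\in[0,1]: t/\alpha\le (R(t)\vee 1)/n\},\qquad R(t)=\#\{i\le n:s_i\le t\}.$$ With $R$ the number of rejected nulls, $V$ that of rejected true nulls and $N$ that of true nulls, let $$\mathrm{pFDR}=E[V/R\mid R>0],\qquad \mathrm{power}=E\Bigl[\frac{R-V}{(n-N)\vee 1}\Bigr],$$ and let $\mathrm{Pow}(\alpha)$ be the limit of the power as $n\to\infty$. **Proposition 4.1.** For every $\boldsymbol\nu\in(0,\infty)^K$: 1. The minimum attainable pFDR of the procedure is $(1-a)\alpha_*$: $\mathrm{pFDR}\ge(1-a)\alpha_*$ for all $n\ge1$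 and $\alpha\in(0,1)$, and for some $\alpha\in(0,1)$ the pFDR tends to $(1-a)\alpha_*$ as $n\to\infty$. Moreover, for every $\alpha\in(\alpha_*,1)$, $\mathrm{pFDR}\to(1-a)\alpha$ as $n\to\infty$. 2. The limit $\mathrm{Pow}(\alpha)$ exists for all $\alpha>\alpha_*$ sufficiently close to $\alpha_*$, and as $\alpha\downarrow\alpha_*$, $$\mathrm{Pow}(\alpha)\sim C(\boldsymbol\nu)\,(\alpha-\alpha_*)^{K/\varepsilon},\qquad C(\boldsymbol\nu)=g(\mathbf 0)\,V_\varepsilon\left(\frac{K+\varepsilon}{a\,\alpha_*^2\,g(\mathbf 0)}\Big/\sum_{k=1}^K\frac{\bar\nu\,\gamma_k}{\nu_k}\right)^{K/\varepsilon}.$$ This asymptotic is maximized at $\boldsymbol\nu=\boldsymbol\gamma$: $C(\boldsymbol\nu)\le C(\boldsymbol\gamma)$ for every $\boldsymbol\nu\in(0,\infty)^K$, with equality if and only if $\boldsymbol\nu=c\boldsymbol\gamma$ for some $c>0$, and, with $\bar\gamma=(\gamma_1\cdots\gamma_K)^{1/K}$, $$C(\boldsymbol\gamma)=g(\mathbf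 0)\,V_\varepsilon\left[\frac{1+\varepsilon/K}{a\,\alpha_*^2\,g(\mathbf 0)\,\bar\gamma}\right]^{K/\varepsilon}.$$ -/

import Mathlib

open Filter Topology MeasureTheory ProbabilityTheory Asymptotics

noncomputable section

namespace EllipsoidFDR

/-- The domain `[0, 1]^K` of multivariate `p`-values. -/
def unitCube (K : ℕ) : Set (Fin K → ℝ) := Set.Icc 0 1

/-- The uniform distribution on `[0, 1]^K`, i.e. the law of `K` independent uniform variables. -/
def uniformLaw (K : ℕ) : Measure (Fin K → ℝ) := volume.restrict (unitCube K)

/-- The law `G` on `[0, 1]^K` with density `g`. -/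
def lawOfDensity {K : ℕ} (g : (Fin K → ℝ) → ℝ) : Measure (Fin K → ℝ) :=
  (uniformLaw K).withDensity fun x => ENNReal.ofReal (g x)

/-- `g` is a continuous probability density on `[0, 1]^K` whose value at the origin is strictly
larger than at every other point. Values of `g` outside the cube play no role. -/
structure IsPeakedDensity {K : ℕ} (g : (Fin K → ℝ) → ℝ) : Prop where
  nonneg : ∀ x ∈ unitCube K, 0 ≤ g x
  integral_eq_one : ∫ x in unitCube K, g x = 1
  continuousOn : ContinuousOn g (unitCube K)
  lt_zero : ∀ x ∈ unitCube K, x ≠ 0 → g x < g 0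

/-- The weighted sum `∑ₖ νₖ xₖ ^ ε`. -/
def weightedPow {K : ℕ} (ν : Fin K → ℝ) (ε : ℝ) (x : Fin K → ℝ) : ℝ := ∑ k, ν k * x k ^ ε

/-- `g(x) = g(0) (1 - ∑ₖ γₖ xₖ ^ ε + r(x))` on `[0, 1]^K`, with `r(x) = o(|x| ^ ε)` as `x → 0` in
the cube. (All norms on `ℝ^K` give the same condition.) -/
def HasExpansion {K : ℕ} (g : (Fin K → ℝ) → ℝ) (γ : Fin K → ℝ) (ε : ℝ) : Prop :=
  ∃ r : (Fin K → ℝ) → ℝ,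
    r =o[𝓝[unitCube K] 0] (fun x => ‖x‖ ^ ε) ∧
      ∀ x ∈ unitCube K, g x = g 0 * (1 - weightedPow γ ε x + r x)

/-- The random effects model: the pairs `(θ i, ξ i)` are independent, `θ i` is Bernoulli(`a`)
(`θ i = 1` meaning that the `i`-th null is false), and conditionally on `θ i = 0` (resp. `1`) the
multivariate `p`-value `ξ i` is uniform on the cube (resp. has density `g`). -/
structure IsRandomEffectsModel {Ω : Type*} [MeasurableSpace Ω] (P : Measure Ω) {K : ℕ} (a : ℝ)
    (g : (Fin K → ℝ) → ℝ) (θ : ℕ → Ω → Fin 2) (ξ : ℕ → Ω → Fin K → ℝ) : Prop where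
  measurable_label : ∀ i, Measurable (θ i)
  measurable_pvalue : ∀ i, Measurable (ξ i)
  indep : iIndepFun (fun i ω => (θ i ω, ξ i ω)) P
  prob_false_null : ∀ i, P {ω | θ i ω = 1} = ENNReal.ofReal a
  law_true_null : ∀ i, (cond P {ω | θ i ω = 0}).map (ξ i) = uniformLaw K
  law_false_null : ∀ i, (cond P {ω | θ i ω = 1}).map (ξ i) = lawOfDensity g

/-- `R(t)`: the number of univariate `p`-values that are at most `t`. -/
def countLE {n : ℕ} (s : Fin n → ℝ) (t : ℝ) : ℕ := (Finset.univ.filter fun i => s i ≤ t).card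

/-- The Benjamini-Hochberg threshold
`τ = sup {t ∈ [0, 1] : t / α ≤ (R(t) ∨ 1) / n}`. -/
def bhThreshold {n : ℕ} (α : ℝ) (s : Fin n → ℝ) : ℝ :=
  sSup {t : ℝ | t ∈ Set.Icc (0 : ℝ) 1 ∧ t / α ≤ (max (countLE s t) 1 : ℕ) / (n : ℝ)}

/-- The set of nulls rejected by the Benjamini-Hochberg procedure at control level `α`. -/
def bhReject {n : ℕ} (α : ℝ) (s : Fin n → ℝ) : Finset (Fin n) :=
  Finset.univ.filter fun i => s i ≤ bhThreshold α s

/-- The region `Γ_u(ν) = {x ∈ [0, 1]^K : ∑ₖ νₖ xₖ ^ ε ≤ u}`. -/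
def region {K : ℕ} (ν : Fin K → ℝ) (ε u : ℝ) : Set (Fin K → ℝ) :=
  {x | x ∈ unitCube K ∧ weightedPow ν ε x ≤ u}

/-- `h(u; ν)`, the Lebesgue measure of `Γ_u(ν)`. -/
def regionVolume {K : ℕ} (ν : Fin K → ℝ) (ε u : ℝ) : ℝ := (volume (region ν ε u)).toReal

/-- `V_ε`, the Lebesgue measure of `{x ∈ [0, 1]^K : ∑ₖ xₖ ^ ε ≤ 1}`. -/
def ballVolume (K : ℕ) (ε : ℝ) : ℝ :=
  (volume {x : Fin K → ℝ | x ∈ unitCube K ∧ ∑ k, x k ^ ε ≤ 1}).toReal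

/-- The nulls among the first `n` that are rejected by the procedure based on the regions
`Γ_u(ν)`: the Benjamini-Hochberg procedure applied to `s i = h(∑ₖ νₖ (ξ i k) ^ ε; ν)`. -/
def ellipsoidReject {Ω : Type*} {K : ℕ} (ξ : ℕ → Ω → Fin K → ℝ) (ν : Fin K → ℝ) (ε α : ℝ) (n : ℕ)
    (ω : Ω) : Finset (Fin n) :=
  bhReject α fun i : Fin n => regionVolume ν ε (weightedPow ν ε (ξ i ω))

/-- `pFDR = E[V / R | R > 0]` of a procedure rejecting the random set `rej` of nulls, where
`R` is the number of rejected nulls and `V` that of rejected true nulls. -/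
def pFDR {Ω : Type*} [MeasurableSpace Ω] (P : Measure Ω) (θ : ℕ → Ω → Fin 2) {n : ℕ}
    (rej : Ω → Finset (Fin n)) : ℝ :=
  ∫ ω, (((rej ω).filter fun i : Fin n => θ (i : ℕ) ω = 0).card : ℝ) / ((rej ω).card : ℝ)
    ∂(cond P {ω | 0 < (rej ω).card})

/-- `power = E[(R - V) / ((n - N) ∨ 1)]`: here `R - V` is the number of rejected false nulls and
`n - N` the total number of false nulls. -/
def power {Ω : Type*} [MeasurableSpace Ω] (P : Measure Ω) (θ : ℕ → Ω → Fin 2) {n : ℕ}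
    (rej : Ω → Finset (Fin n)) : ℝ :=
  ∫ ω, (((rej ω).filter fun i : Fin n => θ (i : ℕ) ω = 1).card : ℝ) /
    ((max (Finset.univ.filter fun i : Fin n => θ (i : ℕ) ω = 1).card 1 : ℕ) : ℝ) ∂P

/-- `β` is the minimum attainable pFDR of a family of procedures `rej α n` (for `n` nulls, with
control level `α ∈ (0, 1)`): the pFDR is never below `β`, and for some `α` it tends to `β` as the
number of nulls tends to infinity. -/
def IsMinAttainablePFDR {Ω : Type*} [MeasurableSpace Ω] (P : Measure Ω) (θ : ℕ → Ω → Fin 2)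
    (rej : ℝ → (n : ℕ) → Ω → Finset (Fin n)) (β : ℝ) : Prop :=
  (∀ α ∈ Set.Ioo (0 : ℝ) 1, ∀ n : ℕ, 1 ≤ n → β ≤ pFDR P θ (rej α n)) ∧
    ∃ α ∈ Set.Ioo (0 : ℝ) 1, Tendsto (fun n => pFDR P θ (rej α n)) atTop (𝓝 β)

/-- `α_* = 1 / (1 - a + a g(0))`. -/
def alphaStar {K : ℕ} (a : ℝ) (g : (Fin K → ℝ) → ℝ) : ℝ := 1 / (1 - a + a * g 0)

/-- The geometric mean of `ν₁, …, ν_K`. -/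
def geomMean {K : ℕ} (ν : Fin K → ℝ) : ℝ := (∏ k, ν k) ^ (1 / (K : ℝ))

/-- The limiting power `Pow(α)` of the procedure based on `Γ_u(ν)`, as the number of nulls tends
to infinity (meaningful when the limit exists). -/
def limitPower {Ω : Type*} [MeasurableSpace Ω] (P : Measure Ω) {K : ℕ} (θ : ℕ → Ω → Fin 2)
    (ξ : ℕ → Ω → Fin K → ℝ) (ν : Fin K → ℝ) (ε α : ℝ) : ℝ :=
  limUnder atTop fun n : ℕ => power P θ (ellipsoidReject ξ ν ε α n)

/-- The constant
`g(0) V_ε ((K + ε) / (a α_*² g(0)) / ∑ₖ ν̄ γₖ / νₖ) ^ (K / ε)`. -/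
def powerConst {K : ℕ} (a : ℝ) (g : (Fin K → ℝ) → ℝ) (γ : Fin K → ℝ) (ε : ℝ) (ν : Fin K → ℝ) : ℝ :=
  g 0 * ballVolume K ε *
    (((K : ℝ) + ε) / (a * alphaStar a g ^ 2 * g 0) / ∑ k, geomMean ν * γ k / ν k) ^ ((K : ℝ) / ε)

end EllipsoidFDR

end

set_option linter.unusedSectionVars false

noncomputable section

namespace EllipsoidFDR

/-! ### The Benjamini-Hochberg index and its leave-one-out version -/

section Deterministic

variable {n : ℕ}

/-! Applying `h(·; ν)` to the weighted sums makes the scores uniform under true nulls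
(`volume_scoreSet`), so the problem is one-dimensional: i.i.d. labelled scores with mixture cdf
`G(t) = (1 - a) t + a F₁(t)`, where `F₁` is the integral of `g` over the score region of volume `t`.
Since `g` peaks strictly at the origin, `F₁(t) < g(0) t` for `t > 0` and `F₁(t) / t → g(0)`. Hence
the line `t / α` dips below `G` exactly when `1 / α < 1 - a + a g(0)`, that is, when `α > α_*`.

The pFDR is handled by leave-one-out. The threshold equals `α k / n` for an integer `k`. Null `i` is
rejected iff `s i ≤ α kᵢ / n`, where `kᵢ` is computed with `s i` replaced by `0`; then `R = kᵢ`, and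
`kᵢ` is independent of `(θ i, s i)`. This expresses the expected share of each label among the
rejections through `F_c(α k / n) / k` (`integral_labelRatio`). For true nulls the share is exactly
`(1 - a) α`, whence `pFDR = (1 - a) α / P(R > 0)`. For false nulls it is at most `a g(0) α`, so `P(R
> 0) ≤ α / α_*`, which is the lower bound. Above `α_*`, Glivenko-Cantelli gives `P(R > 0) → 1`. At
`α_*` itself the threshold collapses to `0`, where `F₁(t) / t` is close to `g(0)`; the false share
then tends to `a g(0) α_*` and again `P(R > 0) → 1`.

For the power, the threshold converges to the crossing point `t₀` of `t / α` with `G`, and the power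
converges to `F₁(t₀)` (`tendsto_power`). The crossing equation reads `g(0) - F₁(t₀) / t₀ = η` with
`η = (1 / α_* - 1 / α) / a`. The left side is asymptotic to `L t₀ ^ (ε / K)`
(`hasDeficitRate_scoreCdf`): it is an average of `g(0) - g` over a small `Γ_u`, computed by
rescaling and the moments of the unit ball. Uniqueness of the crossing requires monotonicity of the
deficit near `0`, so increments of the deficit integral are estimated and not only its values.
Solving for `t₀` gives the constant, and the weighted AM-GM inequality for the ratios `γₖ / νₖ`
maximizes it. -/

lemma countLE_mono (s : Fin n → ℝ) {t t' : ℝ} (h : t ≤ t') : countLE s t ≤ countLE s t' :=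
  Finset.card_le_card fun i hi => by
    simp only [Finset.mem_filter, Finset.mem_univ, true_and] at hi ⊢
    exact hi.trans h

lemma countLE_anti {s s' : Fin n → ℝ} (h : s ≤ s') (t : ℝ) : countLE s' t ≤ countLE s t :=
  Finset.card_le_card fun i hi => by
    simp only [Finset.mem_filter, Finset.mem_univ, true_and] at hi ⊢
    exact (h i).trans hi

lemma countLE_le (s : Fin n → ℝ) (t : ℝ) : countLE s t ≤ n :=
  (Finset.card_filter_le _ _).trans (by simp)

lemma countLE_update_le (s : Fin n → ℝ) (i : Fin n) (y t : ℝ) :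
    countLE (Function.update s i y) t ≤ countLE s t + 1 := by
  unfold countLE
  refine le_trans (Finset.card_le_card (t := insert i (Finset.univ.filter fun j => s j ≤ t)) ?_)
    (Finset.card_insert_le _ _)
  intro j hj
  by_cases hji : j = i
  · simp [hji]
  · simpa [hji, Function.update_of_ne hji] using hj

/-- The Benjamini-Hochberg index: the largest `k ≤ n` with `k ≤ R(α k / n) ∨ 1`. -/
def bhIndex (α : ℝ) (s : Fin n → ℝ) : ℕ :=
  Nat.findGreatest (fun k : ℕ => k ≤ max (countLE s (α * k / n)) 1) n

/-- The largest `k ≤ n` with `k ≤ R(α k / n) + 1`. -/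
def bhIndexSucc (α : ℝ) (s : Fin n → ℝ) : ℕ :=
  Nat.findGreatest (fun k : ℕ => k ≤ countLE s (α * k / n) + 1) n

lemma bhIndex_le (α : ℝ) (s : Fin n → ℝ) : bhIndex α s ≤ n := Nat.findGreatest_le _

lemma one_le_bhIndex (hn : 1 ≤ n) (α : ℝ) (s : Fin n → ℝ) : 1 ≤ bhIndex α s :=
  Nat.le_findGreatest hn (le_max_right _ _)

lemma bhIndex_spec (hn : 1 ≤ n) (α : ℝ) (s : Fin n → ℝ) :
    bhIndex α s ≤ max (countLE s (α * bhIndex α s / n)) 1 :=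
  Nat.findGreatest_spec (P := fun k : ℕ => k ≤ max (countLE s (α * k / n)) 1) hn
    (le_max_right _ _)

lemma le_bhIndex {α : ℝ} {s : Fin n → ℝ} {k : ℕ} (hk : k ≤ n)
    (h : k ≤ max (countLE s (α * k / n)) 1) : k ≤ bhIndex α s :=
  Nat.le_findGreatest hk h

lemma bhIndexSucc_spec (hn : 1 ≤ n) (α : ℝ) (s : Fin n → ℝ) :
    bhIndexSucc α s ≤ countLE s (α * bhIndexSucc α s / n) + 1 :=
  Nat.findGreatest_spec (P := fun k : ℕ => k ≤ countLE s (α * k / n) + 1) hn (by simp)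

lemma bhIndex_le_bhIndexSucc (hn : 1 ≤ n) (α : ℝ) (s : Fin n → ℝ) :
    bhIndex α s ≤ bhIndexSucc α s :=
  Nat.le_findGreatest (bhIndex_le α s) ((bhIndex_spec hn α s).trans (by omega))

lemma mul_div_mono {α : ℝ} (hα : 0 ≤ α) {k l : ℕ} (h : k ≤ l) :
    α * k / n ≤ α * l / n := by gcongr

/-- By monotonicity of the count, `R ∨ 1` at the index is again an admissible index, so maximality
upgrades the defining inequality to an equality. -/
lemma max_countLE_bhIndex (hn : 1 ≤ n) {α : ℝ} (hα : 0 ≤ α) (s : Fin n → ℝ) :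
    max (countLE s (α * bhIndex α s / n)) 1 = bhIndex α s := by
  refine le_antisymm ?_ (bhIndex_spec hn α s)
  refine le_bhIndex (max_le (countLE_le _ _) hn) (max_le_max_right 1 ?_)
  exact countLE_mono s (mul_div_mono hα (bhIndex_spec hn α s))

lemma bhIndex_mul_div_mem (hn : 1 ≤ n) {α : ℝ} (hα : α ∈ Set.Ioo (0 : ℝ) 1) {k : ℕ} (hk : k ≤ n) :
    α * k / n ∈ Set.Icc (0 : ℝ) 1 := by
  have hn' : (0 : ℝ) < n := by exact_mod_cast hn
  have hk' : (k : ℝ) ≤ n := by exact_mod_cast hk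
  have := hα.1
  refine ⟨by positivity, ?_⟩
  rw [div_le_one hn']
  nlinarith [hα.2]

/-- For any admissible `t`, the integer `R(t) ∨ 1` is an admissible index and `t ≤ α (R(t) ∨ 1) /
n`. The supremum is therefore attained on the grid `α k / n`. -/
lemma bhThreshold_eq (hn : 1 ≤ n) {α : ℝ} (hα : α ∈ Set.Ioo (0 : ℝ) 1) (s : Fin n → ℝ) :
    bhThreshold α s = α * bhIndex α s / n := by
  have hn' : (0 : ℝ) < n := by exact_mod_cast hn
  have hα0 := hα.1
  refine IsGreatest.csSup_eq ⟨⟨bhIndex_mul_div_mem hn hα (bhIndex_le α s), ?_⟩, ?_⟩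
  · rw [max_countLE_bhIndex hn hα0.le]
    apply le_of_eq
    field_simp
  · rintro t ⟨-, ht⟩
    have h1 : t ≤ α * (max (countLE s t) 1 : ℕ) / n := by
      rw [div_le_iff₀ hα0] at ht
      calc t ≤ _ := ht
        _ = _ := by ring
    refine h1.trans (mul_div_mono hα0.le (le_bhIndex (max_le (countLE_le _ _) hn) ?_))
    exact max_le_max_right 1 (countLE_mono s h1)

lemma card_bhReject (α : ℝ) (s : Fin n → ℝ) :
    (bhReject α s).card = countLE s (bhThreshold α s) := rfl

/-- A score already below the leave-one-out threshold is counted there whether or not it is lowered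
to `0`, so the larger index remains admissible for the original scores. -/
lemma bhIndex_update_eq (hn : 1 ≤ n) {α : ℝ} {s : Fin n → ℝ} {i : Fin n}
    (hs : 0 ≤ s i) (h : s i ≤ α * bhIndex α (Function.update s i 0) / n) :
    bhIndex α s = bhIndex α (Function.update s i 0) := by
  have hle : Function.update s i 0 ≤ s := by
    intro j
    by_cases hj : j = i
    · subst hj; simpa using hs
    · simp [Function.update_of_ne hj]
  apply le_antisymm
  · exact le_bhIndex (bhIndex_le α s)
      ((bhIndex_spec hn α s).trans (max_le_max_right 1 (countLE_anti hle _)))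
  · refine le_bhIndex (bhIndex_le _ _) ((bhIndex_spec hn α _).trans (max_le_max_right 1 ?_))
    refine Finset.card_le_card fun j hj => ?_
    by_cases hji : j = i
    · subst hji; simpa using h
    · simpa [Function.update_of_ne hji] using hj

lemma bhIndex_le_update (hn : 1 ≤ n) {α : ℝ} {s : Fin n → ℝ} {i : Fin n}
    (hs : 0 ≤ s i) : bhIndex α s ≤ bhIndex α (Function.update s i 0) := by
  have hle : Function.update s i 0 ≤ s := by
    intro j
    by_cases hj : j = i
    · subst hj; simpa using hs
    · simp [Function.update_of_ne hj]
  exact le_bhIndex (bhIndex_le α s)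
      ((bhIndex_spec hn α s).trans (max_le_max_right 1 (countLE_anti hle _)))

/-- Changing one score raises a count by at most one. This supplies a bound that does not depend on
`i`, so a single event controls all leave-one-out indices at once. -/
lemma bhIndex_update_le_bhIndexSucc (hn : 1 ≤ n) (α : ℝ) (s : Fin n → ℝ) (i : Fin n) (y : ℝ) :
    bhIndex α (Function.update s i y) ≤ bhIndexSucc α s := by
  refine Nat.le_findGreatest (bhIndex_le _ _) ((bhIndex_spec hn α _).trans ?_)
  exact max_le (countLE_update_le _ _ _ _) (by omega)

/-- The right-hand side compares `s i` with a quantity that does not involve `s i`; this decouples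
the rejection event. -/
lemma mem_bhReject_iff (hn : 1 ≤ n) {α : ℝ} (hα : α ∈ Set.Ioo (0 : ℝ) 1) {s : Fin n → ℝ}
    {i : Fin n} (hs : 0 ≤ s i) :
    i ∈ bhReject α s ↔ s i ≤ α * bhIndex α (Function.update s i 0) / n := by
  simp only [bhReject, Finset.mem_filter, Finset.mem_univ, true_and, bhThreshold_eq hn hα]
  constructor
  · exact fun h => h.trans (mul_div_mono hα.1.le (bhIndex_le_update hn hs))
  · intro h
    rwa [bhIndex_update_eq hn hs h]

/-- Once something is rejected, the `∨ 1` in the fixed-point identity is inactive and the index is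
the actual number of rejections. -/
lemma card_bhReject_of_mem (hn : 1 ≤ n) {α : ℝ} (hα : α ∈ Set.Ioo (0 : ℝ) 1) {s : Fin n → ℝ}
    {i : Fin n} (hs : 0 ≤ s i) (hi : i ∈ bhReject α s) :
    (bhReject α s).card = bhIndex α (Function.update s i 0) := by
  rw [← bhIndex_update_eq hn hs ((mem_bhReject_iff hn hα hs).1 hi),
    ← max_countLE_bhIndex hn hα.1.le s, ← bhThreshold_eq hn hα, ← card_bhReject]
  exact (max_eq_left (Finset.card_pos.2 ⟨i, hi⟩)).symm

lemma le_bhThreshold {α : ℝ} {s : Fin n → ℝ} {t : ℝ} (ht : t ∈ Set.Icc (0 : ℝ) 1)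
    (h : t / α ≤ countLE s t / n) : t ≤ bhThreshold α s := by
  refine le_csSup ⟨1, fun x hx => hx.1.2⟩ ⟨ht, h.trans ?_⟩
  gcongr
  exact le_max_left _ _

lemma bhIndexSucc_lt (hn : 1 ≤ n) {α : ℝ} (hα : α ∈ Set.Ioo (0 : ℝ) 1) {s : Fin n → ℝ} {δ : ℝ}
    (h : ∀ t ∈ Set.Icc δ 1, (countLE s t : ℝ) / n + 1 / n < t / α) :
    α * bhIndexSucc α s / n < δ := by
  by_contra! hδ
  have hn' : (0 : ℝ) < n := by exact_mod_cast hn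
  have hα0 := hα.1
  have h1 := h _ ⟨hδ, (bhIndex_mul_div_mem hn hα (Nat.findGreatest_le _)).2⟩
  have h2 : (bhIndexSucc α s : ℝ) ≤ countLE s (α * bhIndexSucc α s / n) + 1 := by
    exact_mod_cast bhIndexSucc_spec hn α s
  have h3 : α * bhIndexSucc α s / n / α = bhIndexSucc α s / n := by field_simp
  rw [h3, ← add_div] at h1
  exact absurd h1 (not_lt.2 (by gcongr))

lemma bhThreshold_lt (hn : 1 ≤ n) {α : ℝ} (hα : α ∈ Set.Ioo (0 : ℝ) 1) {s : Fin n → ℝ} {δ : ℝ}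
    (h : ∀ t ∈ Set.Icc δ 1, (countLE s t : ℝ) / n + 1 / n < t / α) :
    bhThreshold α s < δ := by
  rw [bhThreshold_eq hn hα]
  exact (mul_div_mono hα.1.le (bhIndex_le_bhIndexSucc hn α s)).trans_lt (bhIndexSucc_lt hn hα h)

lemma measurable_countLE (t : ℝ) : Measurable fun s : Fin n → ℝ => countLE s t := by
  have : (fun s : Fin n → ℝ => countLE s t) = fun s => ∑ i, if s i ≤ t then 1 else 0 := by
    funext s
    exact Finset.card_filter _ _
  rw [this]
  refine Finset.measurable_sum _ fun i _ => ?_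
  exact Measurable.ite (measurableSet_le (measurable_pi_apply i) measurable_const)
    measurable_const measurable_const

lemma measurable_bhIndex (α : ℝ) : Measurable fun s : Fin n → ℝ => bhIndex α s :=
  measurable_findGreatest fun _ _ =>
    measurableSet_le measurable_const ((measurable_countLE _).max measurable_const)

lemma measurable_bhIndexSucc (α : ℝ) : Measurable fun s : Fin n → ℝ => bhIndexSucc α s :=
  measurable_findGreatest fun _ _ =>
    measurableSet_le measurable_const ((measurable_countLE _).add measurable_const)

lemma measurableSet_mem_bhReject (hn : 1 ≤ n) {α : ℝ} (hα : α ∈ Set.Ioo (0 : ℝ) 1) (i : Fin n) :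
    MeasurableSet {s : Fin n → ℝ | i ∈ bhReject α s} := by
  simp only [bhReject, Finset.mem_filter, Finset.mem_univ, true_and, bhThreshold_eq hn hα]
  refine measurableSet_le (measurable_pi_apply i) ?_
  have : Measurable fun s : Fin n → ℝ => (bhIndex α s : ℝ) :=
    measurable_from_top.comp (measurable_bhIndex α)
  exact (this.const_mul α).div_const _

end Deterministic

/-! ### Leave-one-out formulas for the expected share of each label -/

/-- Independent identically distributed pairs `(θ i, s i)` of a label and a score in `[0, 1]`, with
`P(θ i = c, s i ≤ t) = F c t`. -/
structure IsScoreModel {Ω : Type*} [MeasurableSpace Ω] (P : Measure Ω) (θ : ℕ → Ω → Fin 2)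
    (s : ℕ → Ω → ℝ) (F : Fin 2 → ℝ → ℝ) : Prop where
  measurable_label : ∀ i, Measurable (θ i)
  measurable_score : ∀ i, Measurable (s i)
  indep : iIndepFun (fun i ω => (θ i ω, s i ω)) P
  ident : ∀ i, IdentDistrib (fun ω => (θ i ω, s i ω)) (fun ω => (θ 0 ω, s 0 ω)) P P
  score_mem : ∀ i ω, s i ω ∈ Set.Icc (0 : ℝ) 1
  cdf : ∀ i c, ∀ t ∈ Set.Icc (0 : ℝ) 1, P.real {ω | θ i ω = c ∧ s i ω ≤ t} = F c t

/-- The first `n` scores. -/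
def firstScores {Ω : Type*} (s : ℕ → Ω → ℝ) (n : ℕ) (ω : Ω) : Fin n → ℝ := fun i => s i ω

/-- The Benjamini-Hochberg index of the first `n` scores with the `i`-th one replaced by `0`. -/
def looIndex {Ω : Type*} (α : ℝ) (s : ℕ → Ω → ℝ) (n : ℕ) (i : Fin n) (ω : Ω) : ℕ :=
  bhIndex α (Function.update (firstScores s n ω) i 0)

/-- The proportion of nulls with label `c` among the rejected ones. -/
def labelRatio {Ω : Type*} (θ : ℕ → Ω → Fin 2) (c : Fin 2) {n : ℕ} (rej : Ω → Finset (Fin n))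
    (ω : Ω) : ℝ :=
  (((rej ω).filter fun i : Fin n => θ (i : ℕ) ω = c).card : ℝ) / ((rej ω).card : ℝ)

namespace IsScoreModel

variable {Ω : Type*} [MeasurableSpace Ω] {P : Measure Ω} [IsProbabilityMeasure P]
  {θ : ℕ → Ω → Fin 2} {s : ℕ → Ω → ℝ} {F : Fin 2 → ℝ → ℝ}

lemma measurable_firstScores (h : IsScoreModel P θ s F) (n : ℕ) : Measurable (firstScores s n) :=
  measurable_pi_lambda _ fun i => h.measurable_score i

lemma measurable_looIndex (h : IsScoreModel P θ s F) (α : ℝ) {n : ℕ} (i : Fin n) :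
    Measurable (looIndex α s n i) := by
  refine (measurable_bhIndex α).comp (measurable_pi_lambda _ fun j => ?_)
  by_cases hj : j = i
  · subst hj; simp
  · simpa [Function.update_of_ne hj, firstScores] using h.measurable_score j

lemma measurableSet_label (h : IsScoreModel P θ s F) (i : ℕ) (c : Fin 2) :
    MeasurableSet {ω | θ i ω = c} :=
  h.measurable_label i (measurableSet_singleton c)

lemma measurableSet_label_score (h : IsScoreModel P θ s F) (i : ℕ) (c : Fin 2) (t : ℝ) :
    MeasurableSet {ω | θ i ω = c ∧ s i ω ≤ t} :=
  (h.measurableSet_label i c).inter (measurableSet_le (h.measurable_score i) measurable_const)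

/-- The leave-one-out index is a function of the pairs `j ≠ i` only, since the `i`-th coordinate is
overwritten by a constant. -/
lemma indepFun_looIndex (h : IsScoreModel P θ s F) (α : ℝ) {n : ℕ} (i : Fin n) :
    IndepFun (fun ω => (θ i ω, s i ω)) (looIndex α s n i) P := by
  have hdisj : Disjoint ({(i : ℕ)} : Finset ℕ) ((Finset.range n).erase i) := by simp
  have hind := h.indep.indepFun_finset _ _ hdisj
    fun j => (h.measurable_label j).prodMk (h.measurable_score j)
  let φ : (({(i : ℕ)} : Finset ℕ) → Fin 2 × ℝ) → Fin 2 × ℝ := fun y => y ⟨i, by simp⟩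
  let y' : (((Finset.range n).erase i : Finset ℕ) → Fin 2 × ℝ) → Fin n → ℝ := fun y j =>
    if hj : (j : ℕ) = i then 0 else (y ⟨j, by simp [hj]⟩).2
  have hy' : Measurable y' := by
    refine measurable_pi_lambda _ fun j => ?_
    by_cases hj : (j : ℕ) = i
    · simp [y', hj]
    · simp only [y', hj, dite_false]
      fun_prop
  have := hind.comp (φ := φ) (ψ := fun y => bhIndex α (y' y)) (by fun_prop)
    ((measurable_bhIndex α).comp hy')
  have heq : looIndex α s n i = (fun y => bhIndex α (y' y)) ∘ fun ω j => (θ j ω, s j ω) := by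
    funext ω
    simp only [looIndex, Function.comp]
    congr 1
    funext j
    by_cases hj : j = i
    · subst hj; simp [y']
    · have : (j : ℕ) ≠ i := fun h => hj (Fin.ext h)
      simp [y', this, Function.update_of_ne hj, firstScores]
  rw [heq]
  exact this

lemma measure_looIndex (h : IsScoreModel P θ s F) {α : ℝ} (hα : α ∈ Set.Ioo (0 : ℝ) 1) {n : ℕ}
    (hn : 1 ≤ n) (i : Fin n) (c : Fin 2) {k : ℕ} (hk : k ≤ n) :
    P.real {ω | (θ i ω = c ∧ s i ω ≤ α * k / n) ∧ looIndex α s n i ω = k}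
      = F c (α * k / n) * P.real {ω | looIndex α s n i ω = k} := by
  have hA : MeasurableSet {x : Fin 2 × ℝ | x.1 = c ∧ x.2 ≤ α * k / n} :=
    (measurable_fst (measurableSet_singleton c)).inter
      (measurableSet_le measurable_snd measurable_const)
  have := (h.indepFun_looIndex α i).measure_inter_preimage_eq_mul _ _ hA (measurableSet_singleton k)
  rw [← h.cdf i c _ (bhIndex_mul_div_mem hn hα hk)]
  simp only [Measure.real]
  rw [← ENNReal.toReal_mul]
  exact congrArg ENNReal.toReal this

lemma measurableSet_mem_reject (h : IsScoreModel P θ s F) {α : ℝ} (hα : α ∈ Set.Ioo (0 : ℝ) 1)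
    {n : ℕ} (i : Fin n) : MeasurableSet {ω | i ∈ bhReject α (firstScores s n ω)} :=
  h.measurable_firstScores n (measurableSet_mem_bhReject (i.pos) hα i)

/-- Each rejected `i` contributes `1 / R`, and there `R` equals its leave-one-out index; splitting
by the value `k` of that index isolates independent events. With no rejection both sides vanish,
thanks to `0 / 0 = 0`. -/
lemma labelRatio_eq_sum (h : IsScoreModel P θ s F) {α : ℝ} (hα : α ∈ Set.Ioo (0 : ℝ) 1) {n : ℕ}
    (hn : 1 ≤ n) (c : Fin 2) (ω : Ω) :
    labelRatio θ c (fun ω => bhReject α (firstScores s n ω)) ω =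
      ∑ i : Fin n, ∑ k ∈ Finset.Icc 1 n,
        {ω | (θ i ω = c ∧ s i ω ≤ α * k / n) ∧ looIndex α s n i ω = k}.indicator
          (fun _ => (1 / k : ℝ)) ω := by
  have hin : ∀ i : Fin n, ∑ k ∈ Finset.Icc 1 n,
        {ω | (θ i ω = c ∧ s i ω ≤ α * k / n) ∧ looIndex α s n i ω = k}.indicator
          (fun _ => (1 / k : ℝ)) ω
      = if i ∈ bhReject α (firstScores s n ω) ∧ θ i ω = c then
          1 / ((bhReject α (firstScores s n ω)).card : ℝ) else 0 := by
    intro i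
    have h0 : 0 ≤ firstScores s n ω i := (h.score_mem i ω).1
    rw [Finset.sum_eq_single (looIndex α s n i ω)]
    · by_cases hi : i ∈ bhReject α (firstScores s n ω) ∧ θ i ω = c
      · rw [if_pos hi, Set.indicator_of_mem, card_bhReject_of_mem hn hα h0 hi.1]
        · rfl
        · exact ⟨⟨hi.2, (mem_bhReject_iff hn hα h0).1 hi.1⟩, rfl⟩
      · rw [if_neg hi, Set.indicator_of_notMem]
        rintro ⟨⟨h1, h2⟩, -⟩
        exact hi ⟨(mem_bhReject_iff hn hα h0).2 h2, h1⟩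
    · intro k _ hk
      exact Set.indicator_of_notMem (fun h' => hk h'.2.symm) _
    · intro hk
      exact absurd (Finset.mem_Icc.2 ⟨one_le_bhIndex hn _ _, bhIndex_le _ _⟩) hk
  simp only [hin]
  rw [← Finset.sum_filter, Finset.sum_const, labelRatio, nsmul_eq_mul, mul_one_div]
  congr 3
  ext i
  simp

lemma integrable_term (h : IsScoreModel P θ s F) (α : ℝ) {n : ℕ} (i : Fin n) (c : Fin 2) (k : ℕ) :
    Integrable ({ω | (θ i ω = c ∧ s i ω ≤ α * k / n) ∧ looIndex α s n i ω = k}.indicator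
          (fun _ => (1 / k : ℝ))) P :=
  (integrable_const _).indicator ((h.measurableSet_label_score i c _).inter
    (h.measurable_looIndex α i (measurableSet_singleton k)))

lemma integrable_labelRatio (h : IsScoreModel P θ s F) {α : ℝ} (hα : α ∈ Set.Ioo (0 : ℝ) 1) {n : ℕ}
    (hn : 1 ≤ n) (c : Fin 2) :
    Integrable (labelRatio θ c (fun ω => bhReject α (firstScores s n ω))) P := by
  rw [funext (h.labelRatio_eq_sum hα hn c)]
  exact integrable_finsetSum _ fun i _ => integrable_finsetSum _ fun k _ =>
    h.integrable_term α i c k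

/-- The leave-one-out formula for the expected proportion of rejected nulls with label `c`. -/
lemma integral_labelRatio (h : IsScoreModel P θ s F) {α : ℝ} (hα : α ∈ Set.Ioo (0 : ℝ) 1) {n : ℕ}
    (hn : 1 ≤ n) (c : Fin 2) :
    ∫ ω, labelRatio θ c (fun ω => bhReject α (firstScores s n ω)) ω ∂P =
      ∑ i : Fin n, ∑ k ∈ Finset.Icc 1 n,
        F c (α * k / n) / k * P.real {ω | looIndex α s n i ω = k} := by
  simp only [h.labelRatio_eq_sum hα hn c]
  rw [integral_finsetSum _ fun i _ => integrable_finsetSum _ fun k _ => h.integrable_term α i c k]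
  refine Finset.sum_congr rfl fun i _ => ?_
  rw [integral_finsetSum _ fun k _ => h.integrable_term α i c k]
  refine Finset.sum_congr rfl fun k hk => ?_
  have hm : MeasurableSet {ω | (θ i ω = c ∧ s i ω ≤ α * k / n) ∧ looIndex α s n i ω = k} :=
    (h.measurableSet_label_score i c _).inter
      (h.measurable_looIndex α i (measurableSet_singleton k))
  rw [integral_indicator_const _ hm,
    h.measure_looIndex hα hn i c (Finset.mem_Icc.1 hk).2, smul_eq_mul]
  ring

lemma sum_measure_looIndex_le (h : IsScoreModel P θ s F) (α : ℝ) {n : ℕ} (i : Fin n) (m : ℕ) :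
    ∑ k ∈ Finset.Icc 1 m, P.real {ω | looIndex α s n i ω = k}
      = P.real {ω | looIndex α s n i ω ≤ m} := by
  have hn : 1 ≤ n := i.pos
  rw [← measureReal_biUnion_finset]
  · congr 1
    ext ω
    simp only [Set.mem_iUnion, Set.mem_ofPred_eq, Finset.mem_Icc, exists_prop]
    constructor
    · rintro ⟨k, hk, rfl⟩
      exact hk.2
    · intro hω
      exact ⟨_, ⟨one_le_bhIndex hn _ _, hω⟩, rfl⟩
  · intro k _ l _ hkl
    exact Set.disjoint_left.2 fun ω h1 h2 => hkl (h1.symm.trans h2)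
  · intro k _
    exact h.measurable_looIndex α i (measurableSet_singleton k)

lemma sum_measure_looIndex (h : IsScoreModel P θ s F) (α : ℝ) {n : ℕ} (i : Fin n) :
    ∑ k ∈ Finset.Icc 1 n, P.real {ω | looIndex α s n i ω = k} = 1 := by
  rw [h.sum_measure_looIndex_le]
  have : {ω | looIndex α s n i ω ≤ n} = Set.univ := Set.eq_univ_of_forall fun ω => bhIndex_le _ _
  simp [this]

/-- An upper bound on the cdf of label `c` bounds the expected proportion of label `c`. -/
lemma integral_labelRatio_le (h : IsScoreModel P θ s F) {α : ℝ} (hα : α ∈ Set.Ioo (0 : ℝ) 1)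
    {n : ℕ} (hn : 1 ≤ n) {c : Fin 2} {b : ℝ} (hb : ∀ t ∈ Set.Icc (0 : ℝ) 1, F c t ≤ b * t) :
    ∫ ω, labelRatio θ c (fun ω => bhReject α (firstScores s n ω)) ω ∂P ≤ b * α := by
  have hn' : (0 : ℝ) < n := by exact_mod_cast hn
  rw [h.integral_labelRatio hα hn]
  calc _ ≤ ∑ i : Fin n, ∑ k ∈ Finset.Icc 1 n,
        b * α / n * P.real {ω | looIndex α s n i ω = k} := by
        refine Finset.sum_le_sum fun i _ => Finset.sum_le_sum fun k hk => ?_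
        refine mul_le_mul_of_nonneg_right ?_ measureReal_nonneg
        have hk' : (0 : ℝ) < k := by exact_mod_cast (Finset.mem_Icc.1 hk).1
        rw [div_le_iff₀ hk']
        refine (hb _ (bhIndex_mul_div_mem hn hα (Finset.mem_Icc.1 hk).2)).trans (le_of_eq ?_)
        ring
    _ = b * α := by
        simp only [← Finset.mul_sum, h.sum_measure_looIndex]
        simp
        field_simp

/-- A lower bound on the cdf of label `c` on `[0, δ]` bounds the expected proportion of
label `c` from below. -/
lemma le_integral_labelRatio (h : IsScoreModel P θ s F) {α : ℝ} (hα : α ∈ Set.Ioo (0 : ℝ) 1)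
    {n : ℕ} (hn : 1 ≤ n) {c : Fin 2} {b δ : ℝ} (hb0 : 0 ≤ b)
    (hb : ∀ t ∈ Set.Icc (0 : ℝ) 1, t ≤ δ → b * t ≤ F c t) :
    b * α * P.real {ω | α * bhIndexSucc α (firstScores s n ω) / n ≤ δ} ≤
      ∫ ω, labelRatio θ c (fun ω => bhReject α (firstScores s n ω)) ω ∂P := by
  have hn' : (0 : ℝ) < n := by exact_mod_cast hn
  have hα0 := hα.1
  set q := P.real {ω | α * bhIndexSucc α (firstScores s n ω) / n ≤ δ} with hq
  rw [h.integral_labelRatio hα hn]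
  have hF : ∀ k ∈ Finset.Icc 1 n, 0 ≤ F c (α * k / n) := fun k hk => by
    rw [← h.cdf 0 c _ (bhIndex_mul_div_mem hn hα (Finset.mem_Icc.1 hk).2)]
    exact measureReal_nonneg
  have key : ∀ i : Fin n, b * α / n * q ≤ ∑ k ∈ Finset.Icc 1 n,
      F c (α * k / n) / k * P.real {ω | looIndex α s n i ω = k} := by
    intro i
    -- On this event every leave-one-out threshold is at most `δ`, so only the indices `k` where the
    -- lower bound on the cdf is available matter.
    have hsub : {ω | α * bhIndexSucc α (firstScores s n ω) / n ≤ δ} ⊆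
        ⋃ k ∈ (Finset.Icc 1 n).filter (fun k : ℕ => α * k / n ≤ δ),
          {ω | looIndex α s n i ω = k} := by
      intro ω hω
      simp only [Set.mem_iUnion, Finset.mem_filter, Finset.mem_Icc, Set.mem_ofPred_eq, exists_prop]
      refine ⟨looIndex α s n i ω, ⟨⟨one_le_bhIndex hn _ _, bhIndex_le _ _⟩, le_trans ?_ hω⟩, rfl⟩
      exact mul_div_mono hα0.le (bhIndex_update_le_bhIndexSucc hn _ _ _ _)
    calc b * α / n * q ≤ b * α / n * ∑ k ∈ (Finset.Icc 1 n).filter (fun k : ℕ => α * k / n ≤ δ),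
          P.real {ω | looIndex α s n i ω = k} := by
          gcongr
          exact (measureReal_mono hsub (measure_ne_top _ _)).trans (measureReal_biUnion_finset_le _ _)
      _ = ∑ k ∈ (Finset.Icc 1 n).filter (fun k : ℕ => α * k / n ≤ δ),
          b * α / n * P.real {ω | looIndex α s n i ω = k} := Finset.mul_sum _ _ _
      _ ≤ ∑ k ∈ (Finset.Icc 1 n).filter (fun k : ℕ => α * k / n ≤ δ),
          F c (α * k / n) / k * P.real {ω | looIndex α s n i ω = k} := by
          refine Finset.sum_le_sum fun k hk => ?_
          obtain ⟨hk, hkδ⟩ := Finset.mem_filter.1 hk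
          refine mul_le_mul_of_nonneg_right ?_ measureReal_nonneg
          have hk' : (0 : ℝ) < k := by exact_mod_cast (Finset.mem_Icc.1 hk).1
          rw [le_div_iff₀ hk']
          refine le_trans (le_of_eq ?_)
            (hb _ (bhIndex_mul_div_mem hn hα (Finset.mem_Icc.1 hk).2) hkδ)
          ring
      _ ≤ _ := by
          refine Finset.sum_le_sum_of_subset_of_nonneg (Finset.filter_subset _ _) fun k hk _ => ?_
          exact mul_nonneg (div_nonneg (hF k hk) (Nat.cast_nonneg _)) measureReal_nonneg
  calc b * α * q = ∑ i : Fin n, b * α / n * q := by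
        simp
        field_simp
    _ ≤ _ := Finset.sum_le_sum fun i _ => key i

/-- The false discovery rate of the Benjamini-Hochberg procedure. -/
lemma integral_labelRatio_zero (h : IsScoreModel P θ s F) {α : ℝ} (hα : α ∈ Set.Ioo (0 : ℝ) 1)
    {n : ℕ} (hn : 1 ≤ n) {b : ℝ} (hb : ∀ t ∈ Set.Icc (0 : ℝ) 1, F 0 t = b * t) :
    ∫ ω, labelRatio θ 0 (fun ω => bhReject α (firstScores s n ω)) ω ∂P = b * α := by
  have hn' : (0 : ℝ) < n := by exact_mod_cast hn
  rw [h.integral_labelRatio hα hn]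
  calc _ = ∑ i : Fin n, ∑ k ∈ Finset.Icc 1 n,
        b * α / n * P.real {ω | looIndex α s n i ω = k} := by
        refine Finset.sum_congr rfl fun i _ => Finset.sum_congr rfl fun k hk => ?_
        have hk' : (0 : ℝ) < k := by exact_mod_cast (Finset.mem_Icc.1 hk).1
        rw [hb _ (bhIndex_mul_div_mem hn hα (Finset.mem_Icc.1 hk).2)]
        field_simp
    _ = b * α := by
        simp only [← Finset.mul_sum, h.sum_measure_looIndex]
        simp
        field_simp

lemma measurableSet_reject_pos (h : IsScoreModel P θ s F) {α : ℝ} (hα : α ∈ Set.Ioo (0 : ℝ) 1)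
    (n : ℕ) : MeasurableSet {ω | 0 < (bhReject α (firstScores s n ω)).card} := by
  have : {ω | 0 < (bhReject α (firstScores s n ω)).card} =
      ⋃ i : Fin n, {ω | i ∈ bhReject α (firstScores s n ω)} := by
    ext ω
    simp [Finset.card_pos, Finset.Nonempty]
  rw [this]
  exact MeasurableSet.iUnion fun i => h.measurableSet_mem_reject hα i

/-- The two shares add up to `1` when something is rejected and, by `0 / 0 = 0`, to `0` otherwise.
Integrating turns the shares into `P(R > 0)`. -/
lemma labelRatio_add {α : ℝ} {n : ℕ} (ω : Ω) :
    labelRatio θ 0 (fun ω => bhReject α (firstScores s n ω)) ω +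
      labelRatio θ 1 (fun ω => bhReject α (firstScores s n ω)) ω =
    {ω | 0 < (bhReject α (firstScores s n ω)).card}.indicator (fun _ => (1 : ℝ)) ω := by
  have hsum : ((bhReject α (firstScores s n ω)).filter fun i : Fin n => θ (i : ℕ) ω = 0).card +
      ((bhReject α (firstScores s n ω)).filter fun i : Fin n => θ (i : ℕ) ω = 1).card =
      (bhReject α (firstScores s n ω)).card := by
    rw [← Finset.card_filter_add_card_filter_not (s := bhReject α (firstScores s n ω))
      (fun i : Fin n => θ (i : ℕ) ω = 0)]
    congr 3
    funext i
    have : ∀ x : Fin 2, (x = 1) = ¬ x = 0 := by decide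
    exact this _
  rw [labelRatio, labelRatio, ← add_div, ← Nat.cast_add, hsum]
  by_cases hc : 0 < (bhReject α (firstScores s n ω)).card
  · rw [Set.indicator_of_mem (by exact hc), div_self]
    exact_mod_cast hc.ne'
  · rw [Set.indicator_of_notMem (by exact hc)]
    simp only [not_lt, nonpos_iff_eq_zero] at hc
    simp [hc]

lemma measureReal_reject_pos (h : IsScoreModel P θ s F) {α : ℝ} (hα : α ∈ Set.Ioo (0 : ℝ) 1)
    {n : ℕ} (hn : 1 ≤ n) :
    P.real {ω | 0 < (bhReject α (firstScores s n ω)).card} =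
      ∫ ω, labelRatio θ 0 (fun ω => bhReject α (firstScores s n ω)) ω ∂P +
      ∫ ω, labelRatio θ 1 (fun ω => bhReject α (firstScores s n ω)) ω ∂P := by
  rw [← integral_add (h.integrable_labelRatio hα hn 0) (h.integrable_labelRatio hα hn 1)]
  simp only [labelRatio_add]
  rw [integral_indicator_const _ (h.measurableSet_reject_pos hα n)]
  simp

/-- The ratio `V / R` vanishes where nothing is rejected, so conditioning merely divides its
unconditional mean by `P(R > 0)`. -/
lemma pFDR_eq (h : IsScoreModel P θ s F) {α : ℝ} (hα : α ∈ Set.Ioo (0 : ℝ) 1)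
    {n : ℕ} (hn : 1 ≤ n) {b : ℝ} (hb : ∀ t ∈ Set.Icc (0 : ℝ) 1, F 0 t = b * t) :
    pFDR P θ (fun ω => bhReject α (firstScores s n ω)) =
      b * α / P.real {ω | 0 < (bhReject α (firstScores s n ω)).card} := by
  rw [← h.integral_labelRatio_zero hα hn hb, pFDR, ProbabilityTheory.cond, integral_smul_measure,
    setIntegral_eq_integral_of_forall_compl_eq_zero]
  · rw [ENNReal.toReal_inv, smul_eq_mul, div_eq_inv_mul]
    rfl
  · intro ω hω
    have : (bhReject α (firstScores s n ω)).card = 0 := by simpa using hω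
    simp [this]

end IsScoreModel

/-! ### Uniform convergence of the empirical distributions -/

/-- The number of nulls among the first `n` with label `c` and score at most `t`. -/
def labelCount {Ω : Type*} (θ : ℕ → Ω → Fin 2) (s : ℕ → Ω → ℝ) (c : Fin 2) (n : ℕ) (t : ℝ)
    (ω : Ω) : ℕ :=
  ((Finset.range n).filter fun i => θ i ω = c ∧ s i ω ≤ t).card

/-- The empirical joint distribution of labels and scores converges uniformly to `F`. -/
def EmpiricalConverges {Ω : Type*} (θ : ℕ → Ω → Fin 2) (s : ℕ → Ω → ℝ) (F : Fin 2 → ℝ → ℝ)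
    (ω : Ω) : Prop :=
  ∀ c, ∀ e > (0 : ℝ), ∀ᶠ n : ℕ in atTop, ∀ t ∈ Set.Icc (0 : ℝ) 1,
    |(labelCount θ s c n t ω : ℝ) / n - F c t| ≤ e

/-- Two nondecreasing functions, one of them Lipschitz, that are close on a grid are close
everywhere. -/
lemma abs_sub_le_of_grid {f G : ℝ → ℝ} {L e : ℝ} (hf : Monotone f)
    (hL : ∀ x ∈ Set.Icc (0 : ℝ) 1, ∀ y ∈ Set.Icc (0 : ℝ) 1, x ≤ y → G y - G x ≤ L * (y - x))
    (hL0 : 0 ≤ L) {m : ℕ} (hm : 0 < m)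
    (h : ∀ j ∈ Finset.range (m + 1), |f (j / m) - G (j / m)| ≤ e) {t : ℝ}
    (ht : t ∈ Set.Icc (0 : ℝ) 1) : |f t - G t| ≤ e + L / m := by
  have hm' : (0 : ℝ) < m := by exact_mod_cast hm
  have ht0 : 0 ≤ t * m := mul_nonneg ht.1 hm'.le
  have htm : t * m ≤ m := by nlinarith [ht.2]
  have hc : ⌈t * m⌉₊ ≤ m := Nat.ceil_le.2 htm
  have hfl : ⌊t * m⌋₊ ≤ m := (Nat.floor_le_ceil _).trans hc
  have mem : ∀ j : ℕ, j ≤ m → (j / m : ℝ) ∈ Set.Icc (0 : ℝ) 1 := fun j hj =>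
    ⟨by positivity, by rw [div_le_one hm']; exact_mod_cast hj⟩
  have h1 : (⌊t * m⌋₊ / m : ℝ) ≤ t := by
    rw [div_le_iff₀ hm']; exact Nat.floor_le ht0
  have h2 : t ≤ (⌈t * m⌉₊ / m : ℝ) := by
    rw [le_div_iff₀ hm']; exact Nat.le_ceil _
  have h3 : (⌈t * m⌉₊ / m : ℝ) - t ≤ 1 / m := by
    rw [sub_le_iff_le_add, div_le_iff₀ hm']
    have := (Nat.ceil_lt_add_one ht0).le
    calc _ ≤ t * m + 1 := this
      _ = _ := by field_simp; ring
  have h4 : t - (⌊t * m⌋₊ / m : ℝ) ≤ 1 / m := by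
    rw [sub_le_iff_le_add, ← add_div, le_div_iff₀ hm']
    linarith [(Nat.lt_floor_add_one (t * m)).le]
  have a1 := abs_le.1 (h ⌊t * m⌋₊ (Finset.mem_range.2 (by omega)))
  have a2 := abs_le.1 (h ⌈t * m⌉₊ (Finset.mem_range.2 (by omega)))
  have b1 := hf h1
  have b2 := hf h2
  have c1 := hL _ (mem _ hfl) _ ht h1
  have c2 := hL _ ht _ (mem _ hc) h2
  have d1 : L * ((⌈t * m⌉₊ / m : ℝ) - t) ≤ L / m := by
    rw [div_eq_mul_one_div L]; exact mul_le_mul_of_nonneg_left h3 hL0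
  have d2 : L * (t - (⌊t * m⌋₊ / m : ℝ)) ≤ L / m := by
    rw [div_eq_mul_one_div L]; exact mul_le_mul_of_nonneg_left h4 hL0
  rw [abs_le]
  constructor <;> linarith [a1.1, a1.2, a2.1, a2.2]

lemma labelCount_mono {Ω : Type*} (θ : ℕ → Ω → Fin 2) (s : ℕ → Ω → ℝ) (c : Fin 2) (n : ℕ)
    (ω : Ω) : Monotone fun t => labelCount θ s c n t ω := fun _ _ h =>
  Finset.card_le_card (Finset.monotone_filter_right _ fun _ _ hi => ⟨hi.1, hi.2.trans h⟩)

lemma card_filter_fin_eq_range (n : ℕ) (p : ℕ → Prop) [DecidablePred p] :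
    (Finset.univ.filter fun i : Fin n => p i).card = ((Finset.range n).filter p).card := by
  rw [Finset.card_filter, Finset.card_filter, Finset.sum_range]

lemma countLE_firstScores {Ω : Type*} (θ : ℕ → Ω → Fin 2) (s : ℕ → Ω → ℝ) (n : ℕ) (t : ℝ)
    (ω : Ω) : countLE (firstScores s n ω) t = labelCount θ s 0 n t ω + labelCount θ s 1 n t ω := by
  unfold countLE firstScores labelCount
  rw [card_filter_fin_eq_range n fun i => s i ω ≤ t,
    ← Finset.card_filter_add_card_filter_not
      (s := (Finset.range n).filter fun i => s i ω ≤ t) (fun i => θ i ω = 0),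
    Finset.filter_filter, Finset.filter_filter]
  have : ∀ x : Fin 2, (¬ x = 0) ↔ x = 1 := by decide
  congr 2 <;> ext i <;> simp [this, and_comm]

/-- The function `(1 - a) t` for label `0` and `a F₁(t)` for label `1`. -/
def mixtureCdf (a : ℝ) (F₁ : ℝ → ℝ) (c : Fin 2) (t : ℝ) : ℝ :=
  if c = 0 then (1 - a) * t else a * F₁ t

/-- A cdf on `[0, 1]` whose density is at most `b`, with the bound approached at `0` only. -/
structure IsPeakedCdf (b : ℝ) (F₁ : ℝ → ℝ) : Prop where
  zero : F₁ 0 = 0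
  one : F₁ 1 = 1
  mono : ∀ x ∈ Set.Icc (0 : ℝ) 1, ∀ y ∈ Set.Icc (0 : ℝ) 1, x ≤ y → F₁ x ≤ F₁ y
  sub_le : ∀ x ∈ Set.Icc (0 : ℝ) 1, ∀ y ∈ Set.Icc (0 : ℝ) 1, x ≤ y → F₁ y - F₁ x ≤ b * (y - x)
  lt : ∀ t ∈ Set.Ioc (0 : ℝ) 1, F₁ t < b * t
  slope : Tendsto (fun t => F₁ t / t) (𝓝[>] 0) (𝓝 b)

lemma IsPeakedCdf.one_lt {b : ℝ} {F₁ : ℝ → ℝ} (h : IsPeakedCdf b F₁) : 1 < b := by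
  have := h.lt 1 ⟨one_pos, le_rfl⟩
  rwa [h.one, mul_one] at this

lemma IsPeakedCdf.continuousOn {b : ℝ} {F₁ : ℝ → ℝ} (h : IsPeakedCdf b F₁) :
    ContinuousOn F₁ (Set.Icc 0 1) := by
  have hb := h.one_lt
  refine (LipschitzOnWith.of_dist_le_mul (K := ⟨b, by linarith⟩) ?_).continuousOn
  intro x hx y hy
  rw [Real.dist_eq, Real.dist_eq]
  rcases le_total x y with hxy | hxy
  · rw [abs_sub_comm, abs_sub_comm x, abs_of_nonneg (sub_nonneg.2 (h.mono x hx y hy hxy)),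
      abs_of_nonneg (sub_nonneg.2 hxy)]
    exact h.sub_le x hx y hy hxy
  · rw [abs_of_nonneg (sub_nonneg.2 (h.mono y hy x hx hxy)), abs_of_nonneg (sub_nonneg.2 hxy)]
    exact h.sub_le y hy x hx hxy

lemma IsPeakedCdf.exists_slope {b : ℝ} {F₁ : ℝ → ℝ} (h : IsPeakedCdf b F₁) {η : ℝ} (hη : 0 < η) :
    ∃ δ ∈ Set.Ioo (0 : ℝ) 1, ∀ t ∈ Set.Icc (0 : ℝ) δ, (b - η) * t ≤ F₁ t := by
  have h1 := h.slope.eventually (lt_mem_nhds (show b - η < b by linarith))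
  obtain ⟨u, hu, hsub⟩ := mem_nhdsGT_iff_exists_Ioo_subset.1 h1
  have hu0 : (0 : ℝ) < u := hu
  refine ⟨min (u / 2) (1 / 2), ⟨by positivity, ?_⟩, fun t ht => ?_⟩
  · exact (min_le_right _ _).trans_lt (by norm_num)
  rcases ht.1.eq_or_lt with h0 | h0
  · rw [← h0, h.zero, mul_zero]
  · have : b - η < F₁ t / t :=
      hsub ⟨h0, (ht.2.trans (min_le_left _ _)).trans_lt (half_lt_self hu0)⟩
    exact ((lt_div_iff₀ h0).1 this).le

/-- The probability of measurable events that hold eventually, almost surely, tends to `1`. -/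
lemma tendsto_measureReal_one {Ω : Type*} [MeasurableSpace Ω] {P : Measure Ω}
    [IsProbabilityMeasure P] {A : ℕ → Set Ω} (hA : ∀ n, MeasurableSet (A n))
    (h : ∀ᵐ ω ∂P, ∀ᶠ n in atTop, ω ∈ A n) : Tendsto (fun n => P.real (A n)) atTop (𝓝 1) := by
  have := tendsto_integral_of_dominated_convergence (μ := P)
    (F := fun n => (A n).indicator fun _ => (1 : ℝ)) (f := fun _ => 1) (fun _ => 1)
    (fun n => (measurable_const.indicator (hA n)).aestronglyMeasurable) (integrable_const _)
    (fun n => Eventually.of_forall fun ω => by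
      by_cases hω : ω ∈ A n <;> simp [hω])
    (by
      filter_upwards [h] with ω hω
      refine tendsto_const_nhds.congr' ?_
      filter_upwards [hω] with n hn
      rw [Set.indicator_of_mem hn])
  simpa [integral_indicator_const _ (hA _)] using this

namespace IsScoreModel

variable {Ω : Type*} [MeasurableSpace Ω] {P : Measure Ω} [IsProbabilityMeasure P]
  {θ : ℕ → Ω → Fin 2} {s : ℕ → Ω → ℝ} {F : Fin 2 → ℝ → ℝ}

/-- The strong law of large numbers for the indicators of `θ i = c`, `s i ≤ t`. -/
lemma ae_tendsto_labelCount (h : IsScoreModel P θ s F) (c : Fin 2) {t : ℝ}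
    (ht : t ∈ Set.Icc (0 : ℝ) 1) :
    ∀ᵐ ω ∂P, Tendsto (fun n : ℕ => (labelCount θ s c n t ω : ℝ) / n) atTop (𝓝 (F c t)) := by
  let φ : Fin 2 × ℝ → ℝ := {x | x.1 = c ∧ x.2 ≤ t}.indicator fun _ => 1
  have hA : MeasurableSet {x : Fin 2 × ℝ | x.1 = c ∧ x.2 ≤ t} :=
    (measurable_fst (measurableSet_singleton c)).inter
      (measurableSet_le measurable_snd measurable_const)
  have hφ : Measurable φ := measurable_const.indicator hA
  have hX : ∀ i ω, φ (θ i ω, s i ω) = {ω | θ i ω = c ∧ s i ω ≤ t}.indicator (fun _ => 1) ω :=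
    fun i ω => rfl
  have hmean : ∫ ω, φ (θ 0 ω, s 0 ω) ∂P = F c t := by
    simp only [hX]
    rw [integral_indicator_const _ (h.measurableSet_label_score 0 c t), h.cdf 0 c t ht]
    simp
  have := strong_law_ae_real (μ := P) (fun i ω => φ (θ i ω, s i ω))
    ((integrable_const (1 : ℝ)).indicator (h.measurableSet_label_score 0 c t))
    (fun i j hij => (h.indep.indepFun hij).comp hφ hφ) (fun i => (h.ident i).comp hφ)
  rw [hmean] at this
  filter_upwards [this] with ω hω
  refine hω.congr fun n => ?_
  congr 1
  rw [labelCount, Finset.card_filter]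
  push_cast
  refine Finset.sum_congr rfl fun i _ => ?_
  rw [hX]
  by_cases hi : θ i ω = c ∧ s i ω ≤ t
  · rw [if_pos hi, Set.indicator_of_mem (by exact hi)]
  · rw [if_neg hi, Set.indicator_of_notMem (by exact hi)]

/-- The Glivenko-Cantelli theorem for Lipschitz `F`. -/
lemma ae_empiricalConverges (h : IsScoreModel P θ s F) {L : ℝ} (hL0 : 0 ≤ L)
    (hL : ∀ c, ∀ x ∈ Set.Icc (0 : ℝ) 1, ∀ y ∈ Set.Icc (0 : ℝ) 1, x ≤ y →
      F c y - F c x ≤ L * (y - x)) :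
    ∀ᵐ ω ∂P, EmpiricalConverges θ s F ω := by
  have h1 : ∀ᵐ ω ∂P, ∀ c : Fin 2, ∀ m : ℕ, ∀ j ∈ Finset.range (m + 1 + 1),
      Tendsto (fun n : ℕ => (labelCount θ s c n (j / (m + 1 : ℕ)) ω : ℝ) / n) atTop
        (𝓝 (F c (j / (m + 1 : ℕ)))) := by
    rw [ae_all_iff]
    intro c
    rw [ae_all_iff]
    intro m
    rw [Filter.eventually_all_finset]
    intro j hj
    refine h.ae_tendsto_labelCount c ⟨by positivity, ?_⟩
    rw [div_le_one (by positivity)]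
    exact_mod_cast Nat.lt_succ_iff.1 (Finset.mem_range.1 hj)
  filter_upwards [h1] with ω hω c e he
  -- The mesh `1 / (m + 1)` is chosen so that the Lipschitz error between grid points is at most `e
  -- / 2`; the other half is the error on the grid.
  obtain ⟨m, hm⟩ := exists_nat_gt (L / (e / 2))
  have hm1 : L / (m + 1 : ℕ) ≤ e / 2 := by
    rw [div_lt_iff₀ (by positivity)] at hm
    rw [div_le_iff₀ (by positivity)]
    push_cast
    nlinarith
  have h2 : ∀ᶠ n : ℕ in atTop, ∀ j ∈ Finset.range (m + 1 + 1),
      |(labelCount θ s c n (j / (m + 1 : ℕ)) ω : ℝ) / n - F c (j / (m + 1 : ℕ))| ≤ e / 2 := by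
    rw [Filter.eventually_all_finset]
    intro j hj
    have := (hω c m j hj).eventually (Metric.closedBall_mem_nhds _ (half_pos he))
    filter_upwards [this] with n hn
    rwa [Real.dist_eq] at hn
  filter_upwards [h2] with n hn t ht
  have hf : Monotone fun t => (labelCount θ s c n t ω : ℝ) / n := fun x y hxy => by
    have : (labelCount θ s c n x ω : ℝ) ≤ labelCount θ s c n y ω := by
      exact_mod_cast labelCount_mono θ s c n ω hxy
    dsimp only
    gcongr
  exact (abs_sub_le_of_grid hf (hL c) hL0 (Nat.succ_pos m) hn ht).trans (by linarith)

end IsScoreModel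

/-! ### Locating the threshold from the limiting mixture cdf -/

section Peaked

variable {a b : ℝ} {F₁ : ℝ → ℝ}

lemma mixtureCdf_zero (a : ℝ) (F₁ : ℝ → ℝ) (t : ℝ) : mixtureCdf a F₁ 0 t = (1 - a) * t := rfl

lemma mixtureCdf_one (a : ℝ) (F₁ : ℝ → ℝ) (t : ℝ) : mixtureCdf a F₁ 1 t = a * F₁ t := rfl

lemma IsPeakedCdf.mixture_sub_le (hF : IsPeakedCdf b F₁) (ha0 : 0 < a) (ha1 : a < 1) :
    ∀ c, ∀ x ∈ Set.Icc (0 : ℝ) 1, ∀ y ∈ Set.Icc (0 : ℝ) 1, x ≤ y →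
      mixtureCdf a F₁ c y - mixtureCdf a F₁ c x ≤ b * (y - x) := by
  have hb := hF.one_lt
  refine Fin.forall_fin_two.2 ⟨?_, ?_⟩
  · intro x _ y _ hxy
    rw [mixtureCdf_zero, mixtureCdf_zero]
    nlinarith
  · intro x hx y hy hxy
    rw [mixtureCdf_one, mixtureCdf_one]
    have h1 := hF.sub_le x hx y hy hxy
    have h2 := hF.mono x hx y hy hxy
    nlinarith

/-- The gap `t / α - G(t)` of the mixture cdf `G` is bounded below wherever it is positive. -/
lemma IsPeakedCdf.exists_gap (hF : IsPeakedCdf b F₁) {α δ : ℝ} (hδ : 0 ≤ δ)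
    (h : ∀ t ∈ Set.Icc δ 1, (1 - a) * t + a * F₁ t < t / α) :
    ∃ c > 0, ∀ t ∈ Set.Icc δ 1, (1 - a) * t + a * F₁ t + c ≤ t / α := by
  rcases (Set.Icc δ (1 : ℝ)).eq_empty_or_nonempty with he | hne
  · exact ⟨1, one_pos, fun t ht => by simp [he] at ht⟩
  have hcont : ContinuousOn (fun t => t / α - ((1 - a) * t + a * F₁ t)) (Set.Icc δ 1) := by
    have := hF.continuousOn.mono (Set.Icc_subset_Icc_left hδ)
    fun_prop
  obtain ⟨x, hx, hmin⟩ := isCompact_Icc.exists_isMinOn hne hcont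
  refine ⟨x / α - ((1 - a) * x + a * F₁ x), sub_pos.2 (h x hx), fun t ht => ?_⟩
  have := hmin ht
  simp only [Set.mem_ofPred_eq] at this
  linarith

variable {Ω : Type*} {θ : ℕ → Ω → Fin 2} {s : ℕ → Ω → ℝ} {ω : Ω}

lemma EmpiricalConverges.countLE (hω : EmpiricalConverges θ s (mixtureCdf a F₁) ω) {e : ℝ}
    (he : 0 < e) : ∀ᶠ n : ℕ in atTop, ∀ t ∈ Set.Icc (0 : ℝ) 1,
      |(countLE (firstScores s n ω) t : ℝ) / n - ((1 - a) * t + a * F₁ t)| ≤ e := by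
  filter_upwards [hω 0 (e / 2) (half_pos he), hω 1 (e / 2) (half_pos he)] with n h0 h1 t ht
  have h0 := abs_le.1 (h0 t ht)
  have h1 := abs_le.1 (h1 t ht)
  rw [mixtureCdf_zero] at h0
  rw [mixtureCdf_one] at h1
  rw [countLE_firstScores θ, Nat.cast_add, add_div, abs_le]
  constructor <;> linarith [h0.1, h0.2, h1.1, h1.2]

lemma EmpiricalConverges.eventually_lt (hω : EmpiricalConverges θ s (mixtureCdf a F₁) ω)
    (hF : IsPeakedCdf b F₁) {α δ : ℝ} (hα : α ∈ Set.Ioo (0 : ℝ) 1) (hδ : 0 ≤ δ)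
    (h : ∀ t ∈ Set.Icc δ 1, (1 - a) * t + a * F₁ t < t / α) :
    ∀ᶠ n : ℕ in atTop, bhThreshold α (firstScores s n ω) < δ ∧
      α * bhIndexSucc α (firstScores s n ω) / n < δ := by
  obtain ⟨c, hc, hgap⟩ := hF.exists_gap hδ h
  have hinv : ∀ᶠ n : ℕ in atTop, (1 / n : ℝ) < c / 2 :=
    tendsto_one_div_atTop_nhds_zero_nat.eventually (gt_mem_nhds (half_pos hc))
  -- The empirical error `c / 4` and the extra `1 / n < c / 2` together stay below the gap `c`.
  filter_upwards [hω.countLE (half_pos (half_pos hc)), hinv, eventually_ge_atTop 1] with n h1 h2 hn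
  have key : ∀ t ∈ Set.Icc δ 1,
      (EllipsoidFDR.countLE (firstScores s n ω) t : ℝ) / n + 1 / n < t / α := by
    intro t ht
    have h3 := abs_le.1 (h1 t ⟨hδ.trans ht.1, ht.2⟩)
    have h4 := hgap t ht
    linarith [h3.2]
  exact ⟨bhThreshold_lt hn hα key, bhIndexSucc_lt hn hα key⟩

/-- The margin `G(t) - t / α` serves as the admissible empirical error. It yields `R(t) / n ≥ t / α
> 0` without the help of `∨ 1`, hence a genuine rejection. -/
lemma EmpiricalConverges.eventually_ge (hω : EmpiricalConverges θ s (mixtureCdf a F₁) ω)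
    {α t : ℝ} (hα : α ∈ Set.Ioo (0 : ℝ) 1) (ht : t ∈ Set.Ioc (0 : ℝ) 1)
    (h : t / α < (1 - a) * t + a * F₁ t) :
    ∀ᶠ n : ℕ in atTop, t ≤ bhThreshold α (firstScores s n ω) ∧
      0 < (bhReject α (firstScores s n ω)).card := by
  filter_upwards [hω.countLE (sub_pos.2 h), eventually_ge_atTop 1] with n h1 hn
  have hn' : (0 : ℝ) < n := by exact_mod_cast hn
  have h2 := (abs_le.1 (h1 t (Set.Ioc_subset_Icc_self ht))).1
  have h3 : t / α ≤ (EllipsoidFDR.countLE (firstScores s n ω) t : ℝ) / n := by linarith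
  have h4 := le_bhThreshold (Set.Ioc_subset_Icc_self ht) h3
  refine ⟨h4, ?_⟩
  rw [card_bhReject]
  refine lt_of_lt_of_le ?_ (countLE_mono _ h4)
  have h5 := (div_pos ht.1 hα.1).trans_le h3
  have h6 := (div_pos_iff_of_pos_right hn').1 h5
  exact_mod_cast h6

end Peaked

/-! ### The critical level, limits of the pFDR and of the power -/

/-- The critical level `1 / (1 - a + a b)`. -/
def criticalLevel (a b : ℝ) : ℝ := 1 / (1 - a + a * b)

section Critical

variable {a b : ℝ} {F₁ : ℝ → ℝ}

lemma criticalLevel_denom (ha0 : 0 < a) (hb : 1 < b) : 1 < 1 - a + a * b := by nlinarith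

lemma criticalLevel_pos (ha0 : 0 < a) (hb : 1 < b) : 0 < criticalLevel a b :=
  one_div_pos.2 (one_pos.trans (criticalLevel_denom ha0 hb))

lemma criticalLevel_lt_one (ha0 : 0 < a) (hb : 1 < b) : criticalLevel a b < 1 := by
  have := criticalLevel_denom ha0 hb
  rw [criticalLevel, div_lt_one (by linarith)]
  exact this

lemma one_div_criticalLevel (a b : ℝ) : 1 / criticalLevel a b = 1 - a + a * b := by
  rw [criticalLevel, one_div_one_div]

lemma div_criticalLevel (a b t : ℝ) : t / criticalLevel a b = (1 - a + a * b) * t := by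
  rw [div_eq_mul_one_div, one_div_criticalLevel, mul_comm]

end Critical

namespace IsScoreModel

variable {Ω : Type*} [MeasurableSpace Ω] {P : Measure Ω} [IsProbabilityMeasure P]
  {θ : ℕ → Ω → Fin 2} {s : ℕ → Ω → ℝ} {a b : ℝ} {F₁ : ℝ → ℝ}

lemma ae_converges (h : IsScoreModel P θ s (mixtureCdf a F₁)) (hF : IsPeakedCdf b F₁)
    (ha0 : 0 < a) (ha1 : a < 1) : ∀ᵐ ω ∂P, EmpiricalConverges θ s (mixtureCdf a F₁) ω :=
  h.ae_empiricalConverges (by linarith [hF.one_lt])  (hF.mixture_sub_le ha0 ha1)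

lemma pFDR_eq_div (h : IsScoreModel P θ s (mixtureCdf a F₁)) {α : ℝ}
    (hα : α ∈ Set.Ioo (0 : ℝ) 1) {n : ℕ} (hn : 1 ≤ n) :
    pFDR P θ (fun ω => bhReject α (firstScores s n ω)) =
      (1 - a) * α / P.real {ω | 0 < (bhReject α (firstScores s n ω)).card} :=
  h.pFDR_eq hα hn fun t _ => mixtureCdf_zero a F₁ t

lemma measureReal_reject_pos_eq (h : IsScoreModel P θ s (mixtureCdf a F₁)) {α : ℝ}
    (hα : α ∈ Set.Ioo (0 : ℝ) 1) {n : ℕ} (hn : 1 ≤ n) :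
    P.real {ω | 0 < (bhReject α (firstScores s n ω)).card} =
      (1 - a) * α + ∫ ω, labelRatio θ 1 (fun ω => bhReject α (firstScores s n ω)) ω ∂P := by
  rw [h.measureReal_reject_pos hα hn,
    h.integral_labelRatio_zero hα hn fun t _ => mixtureCdf_zero a F₁ t]

/-- The cdf bound `F₁(t) ≤ b t` limits the share of false nulls to `a b α`, so `P(R > 0) ≤ (1 - a +
a b) α`. -/
lemma le_pFDR (h : IsScoreModel P θ s (mixtureCdf a F₁)) (hF : IsPeakedCdf b F₁)
    (ha0 : 0 < a) (ha1 : a < 1) {α : ℝ} (hα : α ∈ Set.Ioo (0 : ℝ) 1) {n : ℕ} (hn : 1 ≤ n) :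
    (1 - a) * criticalLevel a b ≤ pFDR P θ (fun ω => bhReject α (firstScores s n ω)) := by
  have hα0 := hα.1
  have h1a : 0 < 1 - a := by linarith
  have hden := criticalLevel_denom ha0 hF.one_lt
  have hle : ∫ ω, labelRatio θ 1 (fun ω => bhReject α (firstScores s n ω)) ω ∂P ≤ a * b * α := by
    refine h.integral_labelRatio_le hα hn fun t ht => ?_
    rw [mixtureCdf_one, mul_assoc]
    refine mul_le_mul_of_nonneg_left ?_ ha0.le
    rcases ht.1.eq_or_lt with h0 | h0
    · rw [← h0, hF.zero, mul_zero]
    · exact (hF.lt t ⟨h0, ht.2⟩).le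
  have hge : 0 ≤ ∫ ω, labelRatio θ 1 (fun ω => bhReject α (firstScores s n ω)) ω ∂P :=
    integral_nonneg fun ω => div_nonneg (Nat.cast_nonneg _) (Nat.cast_nonneg _)
  rw [h.pFDR_eq_div hα hn, h.measureReal_reject_pos_eq hα hn]
  have hpos : 0 < (1 - a) * α := mul_pos h1a hα0
  rw [criticalLevel, mul_one_div, div_le_div_iff₀ (by linarith) (by linarith)]
  nlinarith

lemma tendsto_pFDR_of_tendsto (h : IsScoreModel P θ s (mixtureCdf a F₁)) {α : ℝ}
    (hα : α ∈ Set.Ioo (0 : ℝ) 1)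
    (hP : Tendsto (fun n => P.real {ω | 0 < (bhReject α (firstScores s n ω)).card}) atTop (𝓝 1)) :
    Tendsto (fun n => pFDR P θ (fun ω => bhReject α (firstScores s n ω))) atTop
      (𝓝 ((1 - a) * α)) := by
  have h1 : Tendsto (fun n => (1 - a) * α /
      P.real {ω | 0 < (bhReject α (firstScores s n ω)).card}) atTop (𝓝 ((1 - a) * α / 1)) :=
    tendsto_const_nhds.div hP one_ne_zero
  rw [div_one] at h1
  refine h1.congr' ?_
  filter_upwards [eventually_ge_atTop 1] with n hn
  rw [h.pFDR_eq_div hα hn]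

/-- Above the critical level the slope of the mixture cdf at `0` exceeds `1 / α`, so that it lies
above the line at some `δ > 0`, and rejections eventually occur almost surely. -/
lemma tendsto_pFDR (h : IsScoreModel P θ s (mixtureCdf a F₁)) (hF : IsPeakedCdf b F₁)
    (ha0 : 0 < a) (ha1 : a < 1) {α : ℝ} (hα : α ∈ Set.Ioo (criticalLevel a b) 1) :
    Tendsto (fun n => pFDR P θ (fun ω => bhReject α (firstScores s n ω))) atTop
      (𝓝 ((1 - a) * α)) := by
  have hα0 : 0 < α := (criticalLevel_pos ha0 hF.one_lt).trans hα.1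
  have hα' : α ∈ Set.Ioo (0 : ℝ) 1 := ⟨hα0, hα.2⟩
  refine h.tendsto_pFDR_of_tendsto hα' (tendsto_measureReal_one
    (fun n => h.measurableSet_reject_pos hα' n) ?_)
  have hgap : 0 < 1 - a + a * b - 1 / α := by
    rw [sub_pos, ← one_div_criticalLevel]
    exact one_div_lt_one_div_of_lt (criticalLevel_pos ha0 hF.one_lt) hα.1
  -- This `η` spends half of the slope surplus: `1 - a + a (b - η)` still exceeds `1 / α`.
  obtain ⟨δ, hδ, hsl⟩ := hF.exists_slope (η := (1 - a + a * b - 1 / α) / (2 * a)) (by positivity)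
  have h1 : δ / α < (1 - a) * δ + a * F₁ δ := by
    have h2 := mul_le_mul_of_nonneg_left (hsl δ ⟨hδ.1.le, le_rfl⟩) ha0.le
    have h3 : a * ((b - (1 - a + a * b - 1 / α) / (2 * a)) * δ) =
        a * b * δ - (1 - a + a * b - 1 / α) / 2 * δ := by field_simp
    have h4 : δ / α = 1 / α * δ := by ring
    rw [h3] at h2
    rw [h4]
    nlinarith [mul_pos hgap hδ.1]
  filter_upwards [h.ae_converges hF ha0 ha1] with ω hω
  filter_upwards [hω.eventually_ge hα' ⟨hδ.1, hδ.2.le⟩ h1] with n hn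
  exact hn.2

/-- At the critical level, rejections occur with probability tending to `1`, so that the pFDR
tends to its lower bound. -/
lemma tendsto_pFDR_criticalLevel (h : IsScoreModel P θ s (mixtureCdf a F₁))
    (hF : IsPeakedCdf b F₁) (ha0 : 0 < a) (ha1 : a < 1) :
    Tendsto (fun n => pFDR P θ (fun ω => bhReject (criticalLevel a b) (firstScores s n ω))) atTop
      (𝓝 ((1 - a) * criticalLevel a b)) := by
  set α := criticalLevel a b with hαdef
  have hα : α ∈ Set.Ioo (0 : ℝ) 1 :=
    ⟨criticalLevel_pos ha0 hF.one_lt, criticalLevel_lt_one ha0 hF.one_lt⟩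
  have hα0 := hα.1
  have hα1 : ((1 - a) + a * b) * α = 1 := by
    have := criticalLevel_denom ha0 hF.one_lt
    rw [hαdef, criticalLevel, mul_one_div, div_self (by linarith)]
  refine h.tendsto_pFDR_of_tendsto hα ?_
  rw [tendsto_order]
  refine ⟨fun x hx => ?_, fun x hx => Eventually.of_forall fun n => measureReal_le_one.trans_lt hx⟩
  have hb := hF.one_lt
  -- The lower bound for `P(R > 0)` will tend to `1 - a α η`. The first entry of the minimum makes
  -- the loss at most `(1 - x) / 2`, and the second keeps `b - η` nonnegative.
  have hη : 0 < min ((1 - x) / (2 * (a * α))) b := by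
    have : 0 < 1 - x := by linarith
    positivity
  set η := min ((1 - x) / (2 * (a * α))) b with hηdef
  have hη1 : a * α * η ≤ (1 - x) / 2 := by
    calc a * α * η ≤ a * α * ((1 - x) / (2 * (a * α))) := by
          gcongr; exact min_le_left _ _
      _ = (1 - x) / 2 := by field_simp
  have hηb : 0 ≤ b - η := sub_nonneg.2 (min_le_right _ _)
  obtain ⟨δ, hδ, hsl⟩ := hF.exists_slope hη
  have hQ : Tendsto (fun n : ℕ => P.real {ω | α * bhIndexSucc α (firstScores s n ω) / n ≤ δ})
      atTop (𝓝 1) := by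
    refine tendsto_measureReal_one (fun n => ?_) ?_
    · have : Measurable fun ω => (bhIndexSucc α (firstScores s n ω) : ℝ) :=
        measurable_from_top.comp ((measurable_bhIndexSucc α).comp (h.measurable_firstScores n))
      exact measurableSet_le ((this.const_mul α).div_const _) measurable_const
    · filter_upwards [h.ae_converges hF ha0 ha1] with ω hω
      -- At the critical level the line is `(1 - a + a b) t`, the tangent of the mixture cdf at `0`,
      -- which lies strictly above it at every `t > 0`. Hence the threshold is eventually below any
      -- fixed `δ`.
      have hgap : ∀ t ∈ Set.Icc δ 1, (1 - a) * t + a * F₁ t < t / α := by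
        intro t ht
        rw [hαdef, div_criticalLevel]
        have := mul_lt_mul_of_pos_left (hF.lt t ⟨hδ.1.trans_le ht.1, ht.2⟩) ha0
        linarith
      filter_upwards [hω.eventually_lt hF hα hδ.1.le hgap] with n hn
      exact hn.2.le
  have hlim : Tendsto (fun n : ℕ => (1 - a) * α + a * (b - η) * α *
      P.real {ω | α * bhIndexSucc α (firstScores s n ω) / n ≤ δ}) atTop
      (𝓝 ((1 - a) * α + a * (b - η) * α * 1)) := (hQ.const_mul _).const_add _
  have hx' : x < (1 - a) * α + a * (b - η) * α * 1 := by nlinarith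
  filter_upwards [hlim.eventually (lt_mem_nhds hx'), eventually_ge_atTop 1] with n hn hn1
  refine hn.trans_le ?_
  rw [h.measureReal_reject_pos_eq hα hn1]
  refine add_le_add le_rfl (h.le_integral_labelRatio hα hn1 (mul_nonneg ha0.le hηb)
    fun t ht htδ => ?_)
  rw [mixtureCdf_one, mul_assoc]
  exact mul_le_mul_of_nonneg_left (hsl t ⟨ht.1, htδ⟩) ha0.le

lemma power_eq_integral (h : IsScoreModel P θ s (mixtureCdf a F₁)) (α : ℝ) (n : ℕ) :
    power P θ (fun ω => bhReject α (firstScores s n ω)) =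
      ∫ ω, (labelCount θ s 1 n (bhThreshold α (firstScores s n ω)) ω : ℝ) /
        (max (labelCount θ s 1 n 1 ω) 1 : ℕ) ∂P := by
  unfold power
  congr 1
  funext ω
  have h1 : ((bhReject α (firstScores s n ω)).filter fun i : Fin n => θ (i : ℕ) ω = 1).card =
      labelCount θ s 1 n (bhThreshold α (firstScores s n ω)) ω := by
    rw [labelCount, ← card_filter_fin_eq_range n fun i =>
      θ i ω = 1 ∧ s i ω ≤ bhThreshold α (firstScores s n ω), bhReject, Finset.filter_filter]
    refine congrArg Finset.card (Finset.filter_congr fun i _ => ?_)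
    rw [firstScores, and_comm]
  have h2 : (Finset.univ.filter fun i : Fin n => θ (i : ℕ) ω = 1).card =
      labelCount θ s 1 n 1 ω := by
    rw [labelCount, ← card_filter_fin_eq_range n fun i => θ i ω = 1 ∧ s i ω ≤ 1]
    congr 1
    ext i
    simp [(h.score_mem i ω).2]
  rw [h1, h2]

lemma measurable_label_count (h : IsScoreModel P θ s (mixtureCdf a F₁)) (c : Fin 2) (n : ℕ)
    {T : Ω → ℝ} (hT : Measurable T) : Measurable fun ω => labelCount θ s c n (T ω) ω := by
  simp only [labelCount, Finset.card_filter]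
  refine Finset.measurable_sum _ fun i _ => ?_
  exact Measurable.ite ((h.measurableSet_label i c).inter
    (measurableSet_le (h.measurable_score i) hT)) measurable_const measurable_const

lemma bhThreshold_mem_Icc {n : ℕ} (hn : 1 ≤ n) {α : ℝ} (hα : α ∈ Set.Ioo (0 : ℝ) 1)
    (s : Fin n → ℝ) : bhThreshold α s ∈ Set.Icc (0 : ℝ) 1 := by
  rw [bhThreshold_eq hn hα]
  exact bhIndex_mul_div_mem hn hα (bhIndex_le α s)

/-- If `t₀` is the unique positive crossing point of `t / α` with the mixture cdf, the power tends
to `F₁(t₀)`. -/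
lemma tendsto_power (h : IsScoreModel P θ s (mixtureCdf a F₁)) (hF : IsPeakedCdf b F₁)
    (ha0 : 0 < a) (ha1 : a < 1) {α : ℝ} (hα : α ∈ Set.Ioo (0 : ℝ) 1) {t₀ : ℝ}
    (ht₀ : t₀ ∈ Set.Ioo (0 : ℝ) 1)
    (hbelow : ∀ t ∈ Set.Ioo 0 t₀, t / α < (1 - a) * t + a * F₁ t)
    (habove : ∀ t ∈ Set.Ioc t₀ 1, (1 - a) * t + a * F₁ t < t / α) :
    Tendsto (fun n => power P θ (fun ω => bhReject α (firstScores s n ω))) atTop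
      (𝓝 (F₁ t₀)) := by
  simp only [h.power_eq_integral]
  have hlim : ∀ᵐ ω ∂P, Tendsto (fun n : ℕ =>
      (labelCount θ s 1 n (bhThreshold α (firstScores s n ω)) ω : ℝ) /
        (max (labelCount θ s 1 n 1 ω) 1 : ℕ)) atTop (𝓝 (F₁ t₀)) := by
    filter_upwards [h.ae_converges hF ha0 ha1] with ω hω
    -- Points just below `t₀` bound the threshold from below; the gap on `[x, 1]` for `x > t₀`
    -- bounds it from above.
    have hτ : Tendsto (fun n => bhThreshold α (firstScores s n ω)) atTop (𝓝 t₀) := by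
      rw [tendsto_order]
      constructor
      · intro x hx
        obtain ⟨t, ht1, ht2⟩ := exists_between (max_lt hx ht₀.1)
        have ht : t ∈ Set.Ioo 0 t₀ := ⟨(le_max_right _ _).trans_lt ht1, ht2⟩
        filter_upwards [hω.eventually_ge hα ⟨ht.1, (ht2.trans ht₀.2).le⟩ (hbelow t ht)] with n hn
        exact ((le_max_left _ _).trans_lt ht1).trans_le hn.1
      · intro x hx
        filter_upwards [hω.eventually_lt hF hα (ht₀.1.trans hx).le
          fun t ht => habove t ⟨hx.trans_le ht.1, ht.2⟩] with n hn
        exact hn.1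
    have hτF : Tendsto (fun n => a * F₁ (bhThreshold α (firstScores s n ω))) atTop
        (𝓝 (a * F₁ t₀)) := by
      refine Tendsto.const_mul a ?_
      have hc : ContinuousWithinAt F₁ (Set.Icc 0 1) t₀ :=
        hF.continuousOn t₀ (Set.Ioo_subset_Icc_self ht₀)
      refine hc.tendsto.comp (tendsto_nhdsWithin_iff.2 ⟨hτ, ?_⟩)
      filter_upwards [eventually_ge_atTop 1] with n hn
      exact bhThreshold_mem_Icc hn hα _
    have hnum : Tendsto (fun n : ℕ =>
        (labelCount θ s 1 n (bhThreshold α (firstScores s n ω)) ω : ℝ) / n) atTop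
        (𝓝 (a * F₁ t₀)) := by
      -- The threshold is random and moves with `n`, so uniform convergence in `t` is needed here.
      have hdiff : Tendsto (fun n : ℕ =>
          (labelCount θ s 1 n (bhThreshold α (firstScores s n ω)) ω : ℝ) / n -
            a * F₁ (bhThreshold α (firstScores s n ω))) atTop (𝓝 0) := by
        rw [Metric.tendsto_nhds]
        intro e he
        filter_upwards [hω 1 (e / 2) (half_pos he), eventually_ge_atTop 1] with n hn hn1
        rw [Real.dist_eq, sub_zero]
        have := hn _ (bhThreshold_mem_Icc hn1 hα (firstScores s n ω))
        rw [mixtureCdf_one] at this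
        linarith
      simpa using hdiff.add hτF
    have hden : Tendsto (fun n : ℕ => ((max (labelCount θ s 1 n 1 ω) 1 : ℕ) : ℝ) / n) atTop
        (𝓝 a) := by
      have h1 : Tendsto (fun n : ℕ => (labelCount θ s 1 n 1 ω : ℝ) / n) atTop (𝓝 a) := by
        rw [Metric.tendsto_nhds]
        intro e he
        filter_upwards [hω 1 (e / 2) (half_pos he)] with n hn
        have := hn 1 ⟨zero_le_one, le_rfl⟩
        rw [mixtureCdf_one, hF.one, mul_one] at this
        rw [Real.dist_eq]
        linarith
      have h2 := h1.max tendsto_one_div_atTop_nhds_zero_nat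
      -- Dividing `N₁ ∨ 1` by `n` adds only `1 / n → 0` inside the maximum, so the truncation
      -- disappears in the limit.
      rw [max_eq_left ha0.le] at h2
      refine h2.congr fun n => ?_
      rw [Nat.cast_max, Nat.cast_one, max_div_div_right (Nat.cast_nonneg n)]
    have := hnum.div hden ha0.ne'
    rw [mul_div_cancel_left₀ _ ha0.ne'] at this
    refine this.congr' ?_
    filter_upwards [eventually_ge_atTop 1] with n hn
    have hn' : (n : ℝ) ≠ 0 := by exact_mod_cast (by omega : n ≠ 0)
    exact div_div_div_cancel_right₀ hn' _ _
  have hDCT := tendsto_integral_filter_of_dominated_convergence (μ := P) (l := atTop)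
    (F := fun n : ℕ => fun ω =>
      (labelCount θ s 1 n (bhThreshold α (firstScores s n ω)) ω : ℝ) /
        (max (labelCount θ s 1 n 1 ω) 1 : ℕ)) (f := fun _ => F₁ t₀) (fun _ => 1)
    (by
      filter_upwards [eventually_ge_atTop 1] with n hn
      have hT : Measurable fun ω => bhThreshold α (firstScores s n ω) := by
        simp only [bhThreshold_eq hn hα]
        have : Measurable fun ω => (bhIndex α (firstScores s n ω) : ℝ) :=
          measurable_from_top.comp ((measurable_bhIndex α).comp (h.measurable_firstScores n))
        exact (this.const_mul α).div_const _
      have h1 : Measurable fun ω =>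
          (labelCount θ s 1 n (bhThreshold α (firstScores s n ω)) ω : ℝ) :=
        measurable_from_top.comp (h.measurable_label_count 1 n hT)
      have h2 : Measurable fun ω => ((max (labelCount θ s 1 n 1 ω) 1 : ℕ) : ℝ) :=
        measurable_from_top.comp
          ((h.measurable_label_count 1 n measurable_const).max measurable_const)
      exact (h1.div h2).aestronglyMeasurable)
    (by
      filter_upwards [eventually_ge_atTop 1] with n hn
      refine Eventually.of_forall fun ω => ?_
      rw [Real.norm_of_nonneg (by positivity)]
      refine div_le_one_of_le₀ ?_ (Nat.cast_nonneg _)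
      have := (labelCount_mono θ s 1 n ω (bhThreshold_mem_Icc hn hα (firstScores s n ω)).2)
      exact_mod_cast this.trans (le_max_left _ _))
    (integrable_const _) hlim
  simpa using hDCT

end IsScoreModel

/-! ### Crossing points and the power asymptotics -/

/-- The relative deficit `(b t - F₁(t)) / t` of a peaked cdf with respect to its tangent at `0`. -/
def deficit (b : ℝ) (F₁ : ℝ → ℝ) (t : ℝ) : ℝ := (b * t - F₁ t) / t

/-- The deficit behaves like `L t ^ d` at `0` and is strictly increasing near `0`. -/
structure HasDeficitRate (b : ℝ) (F₁ : ℝ → ℝ) (d L : ℝ) : Prop where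
  strictMono : ∃ t₁ ∈ Set.Ioo (0 : ℝ) 1, StrictMonoOn (deficit b F₁) (Set.Ioc 0 t₁)
  tendsto : Tendsto (fun t => deficit b F₁ t / t ^ d) (𝓝[>] 0) (𝓝 L)

/-- `t₀ ∈ (0, 1)` is the unique point of `(0, 1]` where the deficit is `η`, with an upcrossing. -/
structure IsCrossing (b : ℝ) (F₁ : ℝ → ℝ) (η t₀ : ℝ) : Prop where
  mem : t₀ ∈ Set.Ioo (0 : ℝ) 1
  eq : deficit b F₁ t₀ = η
  below : ∀ t ∈ Set.Ioo 0 t₀, deficit b F₁ t < η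
  above : ∀ t ∈ Set.Ioc t₀ 1, η < deficit b F₁ t

section Crossing

variable {b d L : ℝ} {F₁ : ℝ → ℝ}

lemma HasDeficitRate.tendsto_zero (h : HasDeficitRate b F₁ d L) (hd : 0 < d) :
    Tendsto (deficit b F₁) (𝓝[>] 0) (𝓝 0) := by
  have h1 : Tendsto (fun t : ℝ => t ^ d) (𝓝[>] 0) (𝓝 0) := by
    have := (Real.continuousAt_rpow_const 0 d (Or.inr hd.le)).tendsto
    rw [Real.zero_rpow hd.ne'] at this
    exact this.mono_left nhdsWithin_le_nhds
  have h2 := h.tendsto.mul h1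
  rw [mul_zero] at h2
  refine h2.congr' ?_
  filter_upwards [self_mem_nhdsWithin] with t ht
  exact div_mul_cancel₀ _ (Real.rpow_pos_of_pos ht d).ne'

lemma IsPeakedCdf.continuousOn_deficit (hF : IsPeakedCdf b F₁) :
    ContinuousOn (deficit b F₁) (Set.Ioc 0 1) := by
  have h1 : ContinuousOn F₁ (Set.Ioc 0 1) := hF.continuousOn.mono Set.Ioc_subset_Icc_self
  exact ContinuousOn.div (by fun_prop) (by fun_prop) fun t ht => ht.1.ne'

/-- On `(0, t₁]` strict monotonicity and the intermediate value theorem give exactly one crossing.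
On `[t₁, 1]` the function `b t - F₁ t` is nondecreasing and `t ≤ 1`, so the deficit stays above `b
t₁ - F₁ t₁` and small levels are never met again. -/
lemma HasDeficitRate.exists_crossing (h : HasDeficitRate b F₁ d L) (hd : 0 < d)
    (hF : IsPeakedCdf b F₁) : ∃ t₁ ∈ Set.Ioo (0 : ℝ) 1, StrictMonoOn (deficit b F₁) (Set.Ioc 0 t₁) ∧
      ∃ η₀ > 0, ∀ η ∈ Set.Ioo 0 η₀, ∃ t₀, IsCrossing b F₁ η t₀ ∧ t₀ < t₁ := by
  obtain ⟨t₁, ht₁, hmono⟩ := h.strictMono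
  have ht₁' : t₁ ∈ Set.Icc (0 : ℝ) 1 := Set.Ioo_subset_Icc_self ht₁
  have hpos : 0 < b * t₁ - F₁ t₁ := sub_pos.2 (hF.lt t₁ ⟨ht₁.1, ht₁.2.le⟩)
  have hge : ∀ t ∈ Set.Icc t₁ 1, b * t₁ - F₁ t₁ ≤ deficit b F₁ t := by
    intro t ht
    have ht0 := ht₁.1.trans_le ht.1
    have h1 := hF.sub_le t₁ ht₁' t ⟨ht0.le, ht.2⟩ ht.1
    rw [deficit, le_div_iff₀ ht0]
    nlinarith [ht.2]
  refine ⟨t₁, ht₁, hmono, b * t₁ - F₁ t₁, hpos, fun η hη => ?_⟩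
  obtain ⟨t₂, hlt, ht₂⟩ := (((h.tendsto_zero hd).eventually (gt_mem_nhds hη.1)).and
    (Ioo_mem_nhdsGT ht₁.1)).exists
  have h1 : η < deficit b F₁ t₁ := hη.2.trans_le (hge t₁ ⟨le_rfl, ht₁.2.le⟩)
  have hc : ContinuousOn (deficit b F₁) (Set.Icc t₂ t₁) :=
    hF.continuousOn_deficit.mono fun t ht => ⟨ht₂.1.trans_le ht.1, ht.2.trans ht₁.2.le⟩
  obtain ⟨t₀, ht₀, rfl⟩ := intermediate_value_Ioo ht₂.2.le hc ⟨hlt, h1⟩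
  have ht₀0 : 0 < t₀ := ht₂.1.trans ht₀.1
  refine ⟨t₀, ⟨⟨ht₀0, ht₀.2.trans ht₁.2⟩, rfl, fun t ht => ?_, fun t ht => ?_⟩, ht₀.2⟩
  · exact hmono ⟨ht.1, (ht.2.trans ht₀.2).le⟩ ⟨ht₀0, ht₀.2.le⟩ ht.2
  · rcases le_total t t₁ with h2 | h2
    · exact hmono ⟨ht₀0, ht₀.2.le⟩ ⟨ht₀0.trans ht.1, h2⟩ ht.1
    · exact hη.2.trans_le (hge t ⟨h2, ht.2⟩)

/-- With `η` equal to the deficit at `T`, one has `F₁(T) / η ^ (1 / d) = (F₁(T) / T) (T ^ d / η) ^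
(1 / d)`, and the factors tend to `b` and `(1 / L) ^ (1 / d)` because `T → 0`. -/
lemma HasDeficitRate.exists_crossing_fun (h : HasDeficitRate b F₁ d L) (hd : 0 < d) (hL : 0 < L)
    (hF : IsPeakedCdf b F₁) : ∃ T : ℝ → ℝ, (∀ᶠ η in 𝓝[>] (0 : ℝ), IsCrossing b F₁ η (T η)) ∧
      Tendsto (fun η => F₁ (T η) / η ^ (1 / d)) (𝓝[>] 0) (𝓝 (b * (1 / L) ^ (1 / d))) := by
  obtain ⟨t₁, ht₁, hmono, η₀, hη₀, hex⟩ := h.exists_crossing hd hF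
  choose! T hT hTlt using hex
  have hmem : ∀ᶠ η in 𝓝[>] (0 : ℝ), η ∈ Set.Ioo 0 η₀ := Ioo_mem_nhdsGT hη₀
  have hTt : Tendsto T (𝓝[>] 0) (𝓝[>] 0) := by
    refine tendsto_nhdsWithin_iff.2 ⟨?_, ?_⟩
    · rw [tendsto_order]
      constructor
      · intro x hx
        filter_upwards [hmem] with η hη
        exact hx.trans (hT η hη).mem.1
      · intro x hx
        obtain ⟨δ, hδ0, hδ⟩ := exists_between (lt_min hx ht₁.1)
        have hδ1 : δ < t₁ := hδ.trans_le (min_le_right _ _)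
        have hq : 0 < deficit b F₁ δ :=
          div_pos (sub_pos.2 (hF.lt δ ⟨hδ0, (hδ1.trans ht₁.2).le⟩)) hδ0
        filter_upwards [hmem, Ioo_mem_nhdsGT hq] with η hη hη'
        have h1 : deficit b F₁ (T η) < deficit b F₁ δ := by
          rw [(hT η hη).eq]; exact hη'.2
        have h2 := (hmono.lt_iff_lt ⟨(hT η hη).mem.1, (hTlt η hη).le⟩ ⟨hδ0, hδ1.le⟩).1 h1
        exact h2.trans (hδ.trans_le (min_le_left _ _))
    · filter_upwards [hmem] with η hη
      exact (hT η hη).mem.1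
  refine ⟨T, hmem.mono hT, ?_⟩
  have h1 : Tendsto (fun η => (1 / (deficit b F₁ (T η) / T η ^ d)) ^ (1 / d)) (𝓝[>] 0)
      (𝓝 ((1 / L) ^ (1 / d))) := by
    refine Tendsto.rpow_const ?_ (Or.inr (by positivity))
    exact tendsto_const_nhds.div (h.tendsto.comp hTt) hL.ne'
  refine ((hF.slope.comp hTt).mul h1).congr' ?_
  filter_upwards [hmem] with η hη
  have hT0 := (hT η hη).mem.1
  have hη0 := hη.1
  rw [(hT η hη).eq, one_div_div, Real.div_rpow (by positivity) hη0.le, ← Real.rpow_mul hT0.le,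
    mul_one_div_cancel hd.ne', Real.rpow_one, Function.comp]
  field_simp

end Crossing

/-- The limiting power of the procedure near the critical level. -/
lemma IsScoreModel.exists_limitPower {Ω : Type*} [MeasurableSpace Ω] {P : Measure Ω}
    [IsProbabilityMeasure P] {θ : ℕ → Ω → Fin 2} {s : ℕ → Ω → ℝ} {a b d L : ℝ} {F₁ : ℝ → ℝ}
    (h : IsScoreModel P θ s (mixtureCdf a F₁)) (hF : IsPeakedCdf b F₁) (ha0 : 0 < a) (ha1 : a < 1)
    (hrate : HasDeficitRate b F₁ d L) (hd : 0 < d) (hL : 0 < L) :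
    ∃ ρ : ℝ → ℝ, (∀ᶠ α in 𝓝[>] (criticalLevel a b),
      Tendsto (fun n => power P θ (fun ω => bhReject α (firstScores s n ω))) atTop (𝓝 (ρ α))) ∧
      Tendsto (fun α => ρ α / (α - criticalLevel a b) ^ (1 / d)) (𝓝[>] (criticalLevel a b))
        (𝓝 (b * (1 / (a * criticalLevel a b ^ 2 * L)) ^ (1 / d))) := by
  obtain ⟨T, hcross, hasym⟩ := hrate.exists_crossing_fun hd hL hF
  have hc0 := criticalLevel_pos (a := a) ha0 hF.one_lt
  have hc1 := criticalLevel_lt_one (a := a) ha0 hF.one_lt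
  have hc := one_div_criticalLevel a b
  generalize criticalLevel a b = κ at *
  -- The deficit level at which the mixture cdf meets `t / α`. Its factored form below shows that it
  -- is asymptotic to `(α - κ) / (a κ²)`, the source of `α_*²` in the constant.
  let η : ℝ → ℝ := fun α => (1 / κ - 1 / α) / a
  have hη : ∀ α, 0 < α → η α = 1 / (a * α * κ) * (α - κ) := by
    intro α hα
    simp only [η]
    field_simp
  have hcoef : Tendsto (fun α => 1 / (a * α * κ)) (𝓝[>] κ) (𝓝 (1 / (a * κ * κ))) := by
    have : ContinuousAt (fun α => 1 / (a * α * κ)) κ := by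
      refine ContinuousAt.div (by fun_prop) (by fun_prop) (by positivity)
    exact this.tendsto.mono_left nhdsWithin_le_nhds
  have hηt : Tendsto η (𝓝[>] κ) (𝓝[>] 0) := by
    refine tendsto_nhdsWithin_iff.2 ⟨?_, ?_⟩
    · have h1 : ContinuousAt η κ :=
        ContinuousAt.div_const (ContinuousAt.sub (by fun_prop)
          (ContinuousAt.div (by fun_prop) (by fun_prop) hc0.ne')) _
      have h2 : η κ = 0 := by simp [η]
      have := h1.tendsto.mono_left (nhdsWithin_le_nhds (s := Set.Ioi κ))
      rwa [h2] at this
    · filter_upwards [self_mem_nhdsWithin] with α hα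
      have hα' : κ < α := hα
      have hα0 : 0 < α := hc0.trans hα'
      rw [hη α hα0]
      exact mul_pos (by positivity) (sub_pos.2 hα')
  refine ⟨fun α => F₁ (T (η α)), ?_, ?_⟩
  · filter_upwards [hηt.eventually hcross, Ioo_mem_nhdsGT hc1] with α hα hα1
    have hα0 : 0 < α := hc0.trans hα1.1
    have hid : ∀ t, 0 < t → t / α - ((1 - a) * t + a * F₁ t)
        = a * t * (deficit b F₁ t - η α) := by
      intro t ht
      have h1 : a * η α = 1 - a + a * b - 1 / α := by
        simp only [η]; rw [hc]; field_simp
      have h2 : t * deficit b F₁ t = b * t - F₁ t := by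
        rw [deficit]; field_simp
      have h3 : t / α = t * (1 / α) := by ring
      have h4 : (1 / α) = 1 - a + a * b - a * η α := by linarith
      rw [h3, h4]
      linear_combination (-a) * h2
    refine h.tendsto_power hF ha0 ha1 ⟨hα0, hα1.2⟩ hα.mem (fun t ht => ?_) fun t ht => ?_
    · rw [← sub_neg, hid t ht.1]
      exact mul_neg_of_pos_of_neg (mul_pos ha0 ht.1) (sub_neg.2 (hα.below t ht))
    · have ht0 := hα.mem.1.trans ht.1
      rw [← sub_pos, hid t ht0]
      exact mul_pos (mul_pos ha0 ht0) (sub_pos.2 (hα.above t ht))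
  · have h1 := (hasym.comp hηt).mul (hcoef.rpow_const (p := 1 / d) (Or.inr (by positivity)))
    have h2 : b * (1 / L) ^ (1 / d) * (1 / (a * κ * κ)) ^ (1 / d) =
        b * (1 / (a * κ ^ 2 * L)) ^ (1 / d) := by
      rw [mul_assoc, ← Real.mul_rpow (by positivity) (by positivity)]
      congr 2
      field_simp
    rw [h2] at h1
    refine h1.congr' ?_
    filter_upwards [self_mem_nhdsWithin] with α hα
    have hα' : κ < α := hα
    have hα0 : 0 < α := hc0.trans hα'
    have hs : 0 < α - κ := sub_pos.2 hα'
    have hp : 0 < (1 / (a * α * κ)) ^ (1 / d) := by positivity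
    have hp2 : 0 < (α - κ) ^ (1 / d) := by positivity
    simp only [Function.comp]
    nth_rewrite 2 [hη α hα0]
    rw [Real.mul_rpow (by positivity) hs.le]
    field_simp

/-! ### Volumes and moments of the sublevel sets -/

/-- The sublevel set of `∑ₖ νₖ xₖ ^ ε` in the nonnegative orthant. -/
def orthantBall {K : ℕ} (ν : Fin K → ℝ) (ε u : ℝ) : Set (Fin K → ℝ) :=
  {x | 0 ≤ x ∧ weightedPow ν ε x ≤ u}

section Volume

variable {K : ℕ} {ν γ : Fin K → ℝ} {ε u : ℝ}

lemma measurable_weightedPow (ν : Fin K → ℝ) (ε : ℝ) : Measurable (weightedPow ν ε) := by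
  unfold weightedPow
  fun_prop

lemma measurableSet_orthantBall (ν : Fin K → ℝ) (ε u : ℝ) :
    MeasurableSet (orthantBall ν ε u) :=
  measurableSet_Ici.inter (measurableSet_le (measurable_weightedPow ν ε) measurable_const)

lemma weightedPow_nonneg (hν : ∀ k, 0 ≤ ν k) {x : Fin K → ℝ} (hx : 0 ≤ x) :
    0 ≤ weightedPow ν ε x :=
  Finset.sum_nonneg fun k _ => mul_nonneg (hν k) (Real.rpow_nonneg (hx k) ε)

lemma mul_rpow_le_weightedPow (hν : ∀ k, 0 ≤ ν k) {x : Fin K → ℝ} (hx : 0 ≤ x) (k : Fin K) :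
    ν k * x k ^ ε ≤ weightedPow ν ε x :=
  Finset.single_le_sum (f := fun k => ν k * x k ^ ε)
    (fun k _ => mul_nonneg (hν k) (Real.rpow_nonneg (hx k) ε)) (Finset.mem_univ k)

lemma continuous_weightedPow (ν : Fin K → ℝ) (hε : 0 < ε) : Continuous (weightedPow ν ε) := by
  unfold weightedPow
  exact continuous_finsetSum _ fun k _ =>
    continuous_const.mul ((continuous_apply k).rpow_const fun _ => Or.inr hε.le)

lemma weightedPow_mul (hε : 0 < ε) {c : Fin K → ℝ} (hc : ∀ k, 0 < c k) {x : Fin K → ℝ}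
    (hx : 0 ≤ x) : weightedPow ν ε (fun k => c k ^ (1 / ε) * x k) =
      weightedPow (fun k => ν k * c k) ε x := by
  unfold weightedPow
  refine Finset.sum_congr rfl fun k _ => ?_
  rw [Real.mul_rpow (Real.rpow_nonneg (hc k).le _) (hx k), ← Real.rpow_mul (hc k).le,
    one_div_mul_cancel hε.ne', Real.rpow_one, mul_assoc]

/-- The rescaling `x ↦ ((νₖ / u) ^ (1 / ε) xₖ)` maps `orthantBall ν ε u` onto
`orthantBall 1 ε 1`. -/
lemma preimage_orthantBall (hε : 0 < ε) (hν : ∀ k, 0 < ν k) (hu : 0 < u) :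
    (fun (x : Fin K → ℝ) k => (ν k / u) ^ (1 / ε) * x k) ⁻¹' orthantBall 1 ε 1 =
      orthantBall ν ε u := by
  have hc : ∀ k, 0 < ν k / u := fun k => div_pos (hν k) hu
  ext x
  have h0 : (0 ≤ fun k => (ν k / u) ^ (1 / ε) * x k) ↔ 0 ≤ x := by
    simp only [Pi.le_def, Pi.zero_apply]
    refine forall_congr' fun k => ?_
    exact mul_nonneg_iff_of_pos_left (Real.rpow_pos_of_pos (hc k) _)
  simp only [orthantBall, Set.mem_preimage, Set.mem_ofPred_eq, h0]
  refine and_congr_right fun hx => ?_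
  rw [weightedPow_mul hε hc hx]
  have : weightedPow (fun k => (1 : Fin K → ℝ) k * (ν k / u)) ε x = weightedPow ν ε x / u := by
    unfold weightedPow
    rw [Finset.sum_div]
    refine Finset.sum_congr rfl fun k _ => ?_
    simp only [Pi.one_apply]
    ring
  rw [this, div_le_one hu]

lemma map_mul_volume {σ : Fin K → ℝ} (hσ : ∀ k, 0 < σ k) :
    Measure.map (fun (x : Fin K → ℝ) k => σ k * x k) volume =
      ENNReal.ofReal (∏ k, σ k)⁻¹ • volume := by
  have hpos : 0 < ∏ k, σ k := Finset.prod_pos fun k _ => hσ k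
  have h := Real.map_matrix_volume_pi_eq_smul_volume_pi (M := Matrix.diagonal σ)
    (by rw [Matrix.det_diagonal]; exact hpos.ne')
  rw [Matrix.det_diagonal, abs_of_pos (inv_pos.2 hpos)] at h
  rw [← h]
  congr 1
  funext x k
  simp [Matrix.toLin'_apply, Matrix.mulVec_diagonal]

lemma setIntegral_comp_mul {σ : Fin K → ℝ} (hσ : ∀ k, 0 < σ k) {S : Set (Fin K → ℝ)}
    (hS : MeasurableSet S) {f : (Fin K → ℝ) → ℝ} (hf : Measurable f) :
    ∫ x in (fun (x : Fin K → ℝ) k => σ k * x k) ⁻¹' S, f (fun k => σ k * x k) =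
      (∏ k, σ k)⁻¹ * ∫ y in S, f y := by
  have hpos : 0 < ∏ k, σ k := Finset.prod_pos fun k _ => hσ k
  rw [← setIntegral_map hS hf.aestronglyMeasurable
      (measurable_pi_lambda _ fun k => (measurable_pi_apply k).const_mul (σ k)).aemeasurable,
    map_mul_volume hσ,
    Measure.restrict_smul, integral_smul_measure, ENNReal.toReal_ofReal (inv_pos.2 hpos).le,
    smul_eq_mul]

lemma orthantBall_one_subset (hε : 0 < ε) : orthantBall (1 : Fin K → ℝ) ε 1 ⊆ unitCube K := by
  rintro x ⟨hx, hW⟩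
  refine ⟨hx, fun k => ?_⟩
  have h1 := (mul_rpow_le_weightedPow (ν := (1 : Fin K → ℝ)) (ε := ε) (fun _ => zero_le_one) hx
    k).trans hW
  rw [Pi.one_apply, one_mul] at h1
  by_contra! h2
  exact absurd h1 (not_le.2 (Real.one_lt_rpow h2 hε))

lemma ballVolume_eq (hε : 0 < ε) :
    ballVolume K ε = volume.real (orthantBall (1 : Fin K → ℝ) ε 1) := by
  rw [ballVolume, Measure.real]
  congr 2
  ext x
  have hW : weightedPow 1 ε x = ∑ k, x k ^ ε := by simp [weightedPow]
  constructor
  · rintro ⟨h1, h2⟩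
    exact ⟨h1.1, hW.trans_le h2⟩
  · intro h
    exact ⟨orthantBall_one_subset hε h, hW.symm.trans_le h.2⟩

lemma volume_unitCube (K : ℕ) : volume (unitCube K) = 1 := by
  rw [unitCube, Real.volume_Icc_pi]
  simp

lemma integrableOn_rpow_orthantBall_one (hε : 0 < ε) (k : Fin K) :
    IntegrableOn (fun x : Fin K → ℝ => x k ^ ε) (orthantBall 1 ε 1) := by
  have hc : Continuous fun x : Fin K → ℝ => x k ^ ε :=
    (continuous_apply k).rpow_const fun _ => Or.inr hε.le
  exact (hc.continuousOn.integrableOn_compact isCompact_Icc).mono_set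
    (orthantBall_one_subset hε)

lemma ballVolume_pos (hK : 1 ≤ K) (hε : 0 < ε) : 0 < ballVolume K ε := by
  have hK' : (0 : ℝ) < K := by exact_mod_cast hK
  rw [ballVolume_eq hε]
  -- The side `c` satisfies `K c ^ ε = 1`, so the cube of side `c` fits inside the ball.
  set c : ℝ := (1 / (K : ℝ)) ^ (1 / ε) with hc
  have hc0 : 0 < c := by positivity
  have hsub : Set.Icc (0 : Fin K → ℝ) (fun _ => c) ⊆ orthantBall 1 ε 1 := by
    rintro x ⟨hx0, hxc⟩
    refine ⟨hx0, ?_⟩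
    calc weightedPow 1 ε x ≤ ∑ _k : Fin K, 1 / (K : ℝ) := by
          refine Finset.sum_le_sum fun k _ => ?_
          rw [Pi.one_apply, one_mul]
          refine (Real.rpow_le_rpow (hx0 k) (hxc k) hε.le).trans (le_of_eq ?_)
          rw [hc, ← Real.rpow_mul (by positivity), one_div_mul_cancel hε.ne', Real.rpow_one]
      _ = 1 := by simp; field_simp
  have hfin : volume (orthantBall (1 : Fin K → ℝ) ε 1) ≠ ⊤ :=
    ((measure_mono (orthantBall_one_subset hε)).trans_lt (by simp [volume_unitCube])).ne
  refine lt_of_lt_of_le ?_ (measureReal_mono hsub hfin)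
  rw [Measure.real, Real.volume_Icc_pi]
  simp [hc0.le]
  positivity

/-- The volume of `orthantBall ν ε 1`. -/
def orthantVolume (ν : Fin K → ℝ) (ε : ℝ) : ℝ := (∏ k, ν k ^ (1 / ε))⁻¹ * ballVolume K ε

lemma orthantVolume_pos (hK : 1 ≤ K) (hε : 0 < ε) (hν : ∀ k, 0 < ν k) :
    0 < orthantVolume ν ε :=
  mul_pos (inv_pos.2 (Finset.prod_pos fun k _ => Real.rpow_pos_of_pos (hν k) _))
    (ballVolume_pos hK hε)

lemma prod_div_rpow (hν : ∀ k, 0 < ν k) (hu : 0 < u) :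
    (∏ k, (ν k / u) ^ (1 / ε))⁻¹ = (∏ k, ν k ^ (1 / ε))⁻¹ * u ^ ((K : ℝ) / ε) := by
  have : ∀ k, (ν k / u) ^ (1 / ε) = ν k ^ (1 / ε) / u ^ (1 / ε) := fun k =>
    Real.div_rpow (hν k).le hu.le _
  simp only [this, Finset.prod_div_distrib, Finset.prod_const, Finset.card_univ, Fintype.card_fin]
  rw [inv_div, div_eq_inv_mul, ← Real.rpow_natCast, ← Real.rpow_mul hu.le]
  congr 2
  ring

lemma setIntegral_orthantBall (hε : 0 < ε) (hν : ∀ k, 0 < ν k) (hu : 0 < u)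
    {f : (Fin K → ℝ) → ℝ} (hf : Measurable f) :
    ∫ x in orthantBall ν ε u, f (fun k => (ν k / u) ^ (1 / ε) * x k) =
      (∏ k, ν k ^ (1 / ε))⁻¹ * u ^ ((K : ℝ) / ε) * ∫ y in orthantBall 1 ε 1, f y := by
  rw [← preimage_orthantBall hε hν hu, setIntegral_comp_mul
    (fun k => Real.rpow_pos_of_pos (div_pos (hν k) hu) _) (measurableSet_orthantBall _ _ _) hf,
    prod_div_rpow hν hu]

lemma volume_orthantBall_zero (hK : 1 ≤ K) (hν : ∀ k, 0 < ν k) :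
    volume (orthantBall ν ε 0) = 0 := by
  have : Nonempty (Fin K) := ⟨⟨0, hK⟩⟩
  refine measure_mono_null (t := {0}) ?_ (measure_singleton _)
  rintro x ⟨hx, hW⟩
  rw [Set.mem_singleton_iff]
  funext k
  have h1 := (mul_rpow_le_weightedPow (ε := ε) (fun k => (hν k).le) hx k).trans hW
  by_contra h2
  have h3 : 0 < x k := lt_of_le_of_ne (hx k) (Ne.symm h2)
  exact absurd h1 (not_le.2 (mul_pos (hν k) (Real.rpow_pos_of_pos h3 _)))

lemma volume_orthantBall (hK : 1 ≤ K) (hε : 0 < ε) (hν : ∀ k, 0 < ν k) (hu : 0 ≤ u) :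
    volume.real (orthantBall ν ε u) = orthantVolume ν ε * u ^ ((K : ℝ) / ε) := by
  have hK' : (0 : ℝ) < K := by exact_mod_cast hK
  rcases hu.eq_or_lt with rfl | hu
  · rw [Measure.real, volume_orthantBall_zero hK hν, Real.zero_rpow (by positivity)]
    simp
  · have h := setIntegral_orthantBall hε hν hu (f := fun _ => 1) measurable_const
    simp only [setIntegral_const, smul_eq_mul, mul_one] at h
    rw [h, orthantVolume, ballVolume_eq hε]
    ring

lemma orthantBall_subset_Icc (hε : 0 < ε) (hν : ∀ k, 0 < ν k) (u : ℝ) :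
    orthantBall ν ε u ⊆ Set.Icc 0 fun k => (u / ν k) ^ (1 / ε) := by
  rintro x ⟨hx, hW⟩
  refine ⟨hx, fun k => ?_⟩
  have h1 := (mul_rpow_le_weightedPow (ε := ε) (fun k => (hν k).le) hx k).trans hW
  have h2 : x k ^ ε ≤ u / ν k := by rw [le_div_iff₀ (hν k), mul_comm]; exact h1
  calc x k = (x k ^ ε) ^ (1 / ε) := by
        rw [← Real.rpow_mul (hx k), mul_one_div_cancel hε.ne', Real.rpow_one]
    _ ≤ _ := Real.rpow_le_rpow (Real.rpow_nonneg (hx k) _) h2 (by positivity)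

lemma volume_orthantBall_ne_top (hε : 0 < ε) (hν : ∀ k, 0 < ν k) (u : ℝ) :
    volume (orthantBall ν ε u) ≠ ⊤ :=
  ((measure_mono (orthantBall_subset_Icc hε hν u)).trans_lt isCompact_Icc.measure_lt_top).ne

lemma integrableOn_weightedPow (γ : Fin K → ℝ) (hε : 0 < ε) (hν : ∀ k, 0 < ν k) (u : ℝ) :
    IntegrableOn (weightedPow γ ε) (orthantBall ν ε u) :=
  ((continuous_weightedPow γ hε).continuousOn.integrableOn_compact isCompact_Icc).mono_set
    (orthantBall_subset_Icc hε hν u)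

/-- Layer-cake formula: the part of the ball where the sum exceeds `t` has volume `V_ε (1 - t ^ (K /
ε))`, and `1 - t ^ (K / ε)` integrates to `K / (K + ε)` over `[0, 1]`. -/
lemma integral_weightedPow_one (hK : 1 ≤ K) (hε : 0 < ε) :
    ∫ x in orthantBall (1 : Fin K → ℝ) ε 1, weightedPow 1 ε x =
      ballVolume K ε * (K / (K + ε)) := by
  have hK' : (0 : ℝ) < K := by exact_mod_cast hK
  have h1 : ∀ k, (0 : ℝ) < (1 : Fin K → ℝ) k := fun _ => one_pos
  have hV : orthantVolume (1 : Fin K → ℝ) ε = ballVolume K ε := by simp [orthantVolume]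
  have hnn : 0 ≤ᵐ[volume.restrict (orthantBall (1 : Fin K → ℝ) ε 1)] weightedPow 1 ε := by
    filter_upwards [ae_restrict_mem (measurableSet_orthantBall _ _ _)] with x hx
    exact weightedPow_nonneg (fun k => (h1 k).le) hx.1
  rw [Integrable.integral_eq_integral_meas_lt (integrableOn_weightedPow 1 hε h1 1) hnn]
  have hlevel : ∀ t ∈ Set.Ioi (0 : ℝ),
      (volume.restrict (orthantBall (1 : Fin K → ℝ) ε 1)).real {x | t < weightedPow 1 ε x} =
        (Set.Ioc (0 : ℝ) 1).indicator
          (fun t => ballVolume K ε * (1 - t ^ ((K : ℝ) / ε))) t := by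
    intro t ht
    have ht0 : (0 : ℝ) < t := ht
    rw [measureReal_restrict_apply
      (measurableSet_lt measurable_const (measurable_weightedPow 1 ε))]
    have hset : {x : Fin K → ℝ | t < weightedPow 1 ε x} ∩ orthantBall 1 ε 1 =
        orthantBall 1 ε 1 \ orthantBall 1 ε t := by
      ext x
      simp only [orthantBall, Set.mem_inter_iff, Set.mem_ofPred_eq, Set.mem_sdiff, not_and, not_le]
      tauto
    rw [hset]
    by_cases ht1 : t ≤ 1
    · have hsub : orthantBall (1 : Fin K → ℝ) ε t ⊆ orthantBall 1 ε 1 :=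
        fun x hx => ⟨hx.1, hx.2.trans ht1⟩
      rw [Set.indicator_of_mem (by exact ⟨ht0, ht1⟩),
        measureReal_sdiff' (measurableSet_orthantBall _ _ _) (volume_orthantBall_ne_top hε h1 _)
          (volume_orthantBall_ne_top hε h1 _),
        Set.union_eq_self_of_subset_right hsub,
        volume_orthantBall hK hε h1 zero_le_one, volume_orthantBall hK hε h1 ht0.le, hV]
      simp
      ring
    · rw [Set.indicator_of_notMem (fun h => ht1 h.2), Set.sdiff_eq_empty.2, measureReal_empty]
      exact fun x hx => ⟨hx.1, hx.2.trans (not_le.1 ht1).le⟩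
  have hp : 0 < (K : ℝ) / ε := by positivity
  rw [setIntegral_congr_fun measurableSet_Ioi hlevel, setIntegral_indicator measurableSet_Ioc,
    Set.inter_eq_self_of_subset_right Set.Ioc_subset_Ioi_self,
    ← intervalIntegral.integral_of_le zero_le_one, intervalIntegral.integral_const_mul,
    intervalIntegral.integral_sub (by simp)
      (intervalIntegral.intervalIntegrable_rpow' (by linarith)),
    integral_rpow (Or.inl (by linarith))]
  rw [Real.zero_rpow (by positivity)]
  simp
  left
  field_simp
  ring

/-- The unit ball is invariant under transposing coordinates. Thus the single moment of the full sum
determines each coordinate moment. -/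
lemma integral_rpow_swap (i j : Fin K) :
    ∫ x in orthantBall (1 : Fin K → ℝ) ε 1, x i ^ ε =
      ∫ x in orthantBall (1 : Fin K → ℝ) ε 1, x j ^ ε := by
  let e := MeasurableEquiv.piCongrLeft (fun _ : Fin K => ℝ) (Equiv.swap i j)
  have he : MeasurePreserving e volume volume :=
    volume_measurePreserving_piCongrLeft _ (Equiv.swap i j)
  have happ : ∀ (x : Fin K → ℝ) k, e x k = x (Equiv.swap i j k) := by
    intro x k
    have := Equiv.piCongrLeft_apply_apply (fun _ : Fin K => ℝ) (Equiv.swap i j) x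
      (Equiv.swap i j k)
    rwa [Equiv.swap_apply_self] at this
  have hpre : e ⁻¹' orthantBall 1 ε 1 = orthantBall 1 ε 1 := by
    ext x
    have h1 : weightedPow 1 ε (e x) = weightedPow 1 ε x := by
      simp only [weightedPow, happ, Pi.one_apply, one_mul]
      exact Equiv.sum_comp (Equiv.swap i j) fun k => x k ^ ε
    have h2 : 0 ≤ e x ↔ 0 ≤ x := by
      simp only [Pi.le_def, happ, Pi.zero_apply]
      exact (Equiv.swap i j).forall_congr_left (p := fun k => 0 ≤ x (Equiv.swap i j k)) |>.trans
        (by simp)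
    simp only [orthantBall, Set.mem_preimage, Set.mem_ofPred_eq, h1, h2]
  have := he.setIntegral_preimage_emb e.measurableEmbedding (fun x => x i ^ ε)
    (orthantBall 1 ε 1)
  rw [hpre] at this
  rw [← this]
  simp only [happ, Equiv.swap_apply_left]

lemma integral_rpow_one (hK : 1 ≤ K) (hε : 0 < ε) (k : Fin K) :
    ∫ x in orthantBall (1 : Fin K → ℝ) ε 1, x k ^ ε = ballVolume K ε / (K + ε) := by
  have hK' : (0 : ℝ) < K := by exact_mod_cast hK
  have h := integral_weightedPow_one hK hε
  simp only [weightedPow, Pi.one_apply, one_mul] at h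
  rw [integral_finsetSum _ fun j _ => integrableOn_rpow_orthantBall_one hε j,
    Finset.sum_congr rfl fun j _ => integral_rpow_swap (ε := ε) j k] at h
  simp only [Finset.sum_const, Finset.card_univ, Fintype.card_fin, nsmul_eq_mul] at h
  have : (K : ℝ) * ∫ x in orthantBall (1 : Fin K → ℝ) ε 1, x k ^ ε =
      K * (ballVolume K ε / (K + ε)) := by
    rw [h]; ring
  exact mul_left_cancel₀ hK'.ne' this

lemma integral_rpow_orthantBall (hK : 1 ≤ K) (hε : 0 < ε) (hν : ∀ k, 0 < ν k) (hu : 0 < u)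
    (k : Fin K) : ∫ x in orthantBall ν ε u, x k ^ ε =
      orthantVolume ν ε * (u ^ ((K : ℝ) / ε) * u) * (1 / (ν k * (K + ε))) := by
  have hK' : (0 : ℝ) < K := by exact_mod_cast hK
  have h := setIntegral_orthantBall hε hν hu (f := fun y => u / ν k * y k ^ ε) (by fun_prop)
  rw [integral_const_mul (u / ν k) (fun y : Fin K → ℝ => y k ^ ε),
    integral_rpow_one hK hε] at h
  have h2 : ∫ x in orthantBall ν ε u, x k ^ ε =
      ∫ x in orthantBall ν ε u, u / ν k * ((ν k / u) ^ (1 / ε) * x k) ^ ε := by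
    refine setIntegral_congr_fun (measurableSet_orthantBall _ _ _) fun x hx => ?_
    have hc : 0 < ν k / u := div_pos (hν k) hu
    have := hν k
    rw [Real.mul_rpow (Real.rpow_nonneg hc.le _) (hx.1 k), ← Real.rpow_mul hc.le,
      one_div_mul_cancel hε.ne', Real.rpow_one]
    field_simp
  have := hν k
  rw [h2, h, orthantVolume]
  field_simp

/-- The integral of one weighted sum over the sublevel set of another one. -/
lemma integral_weightedPow (hK : 1 ≤ K) (hε : 0 < ε) (hν : ∀ k, 0 < ν k) (γ : Fin K → ℝ)
    (hu : 0 ≤ u) : ∫ x in orthantBall ν ε u, weightedPow γ ε x =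
      orthantVolume ν ε * (u ^ ((K : ℝ) / ε) * u) * ((∑ k, γ k / ν k) / (K + ε)) := by
  have hK' : (0 : ℝ) < K := by exact_mod_cast hK
  rcases hu.eq_or_lt with rfl | hu
  · rw [Measure.restrict_eq_zero.2 (volume_orthantBall_zero hK hν)]
    simp
  · unfold weightedPow
    rw [integral_finsetSum]
    · simp only [integral_const_mul, integral_rpow_orthantBall hK hε hν hu]
      rw [Finset.sum_div, Finset.mul_sum]
      refine Finset.sum_congr rfl fun k _ => ?_
      have := hν k
      field_simp
    · intro k _
      have hc : Continuous fun x : Fin K → ℝ => γ k * x k ^ ε :=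
        continuous_const.mul ((continuous_apply k).rpow_const fun _ => Or.inr hε.le)
      exact (hc.continuousOn.integrableOn_compact isCompact_Icc).mono_set
        (orthantBall_subset_Icc hε hν u)

end Volume

/-! ### Uniformity of the scores under true nulls -/

section Score

variable {K : ℕ} {ν : Fin K → ℝ} {ε u : ℝ}

lemma measurableSet_unitCube (K : ℕ) : MeasurableSet (unitCube K) := measurableSet_Icc

lemma measurableSet_region (ν : Fin K → ℝ) (ε u : ℝ) : MeasurableSet (region ν ε u) :=
  (measurableSet_unitCube K).inter (measurableSet_le (measurable_weightedPow ν ε) measurable_const)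

lemma region_subset (ν : Fin K → ℝ) (ε u : ℝ) : region ν ε u ⊆ unitCube K := fun _ hx => hx.1

lemma volume_ne_top_of_subset_unitCube {S : Set (Fin K → ℝ)} (h : S ⊆ unitCube K) :
    volume S ≠ ⊤ :=
  ((measure_mono h).trans_lt (by simp [volume_unitCube])).ne

lemma regionVolume_eq (ν : Fin K → ℝ) (ε u : ℝ) :
    regionVolume ν ε u = volume.real (region ν ε u) := rfl

lemma regionVolume_mono (ν : Fin K → ℝ) (ε : ℝ) : Monotone (regionVolume ν ε) := fun _ v huv =>
  measureReal_mono (fun _ hx => ⟨hx.1, hx.2.trans huv⟩)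
    (volume_ne_top_of_subset_unitCube (region_subset ν ε v))

lemma regionVolume_mem (ν : Fin K → ℝ) (ε u : ℝ) : regionVolume ν ε u ∈ Set.Icc (0 : ℝ) 1 := by
  refine ⟨measureReal_nonneg, ?_⟩
  have := measureReal_mono (region_subset ν ε u) (volume_ne_top_of_subset_unitCube le_rfl)
  rwa [Measure.real, Measure.real, volume_unitCube, ENNReal.toReal_one] at this

lemma weightedPow_le_sum (hε : 0 < ε) (hν : ∀ k, 0 < ν k) {x : Fin K → ℝ} (hx : x ∈ unitCube K) :
    weightedPow ν ε x ≤ ∑ k, ν k :=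
  Finset.sum_le_sum fun k _ =>
    mul_le_of_le_one_right (hν k).le (Real.rpow_le_one (hx.1 k) (hx.2 k) hε.le)

lemma regionVolume_sum (hε : 0 < ε) (hν : ∀ k, 0 < ν k) : regionVolume ν ε (∑ k, ν k) = 1 := by
  have : region ν ε (∑ k, ν k) = unitCube K :=
    (region_subset ν ε _).antisymm fun x hx => ⟨hx, weightedPow_le_sum hε hν hx⟩
  rw [regionVolume_eq, this, Measure.real, volume_unitCube, ENNReal.toReal_one]

lemma region_subset_orthantBall : region ν ε u ⊆ orthantBall ν ε u := fun _ hx => ⟨hx.1.1, hx.2⟩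

lemma region_eq_orthantBall (hε : 0 < ε) (hν : ∀ k, 0 < ν k) (hu : ∀ k, u ≤ ν k) :
    region ν ε u = orthantBall ν ε u := by
  refine region_subset_orthantBall.antisymm fun x hx => ⟨⟨hx.1, fun k => ?_⟩, hx.2⟩
  have h1 := ((mul_rpow_le_weightedPow (ε := ε) (fun k => (hν k).le) hx.1 k).trans hx.2).trans
    (hu k)
  by_contra! h2
  have h3 : 1 < x k ^ ε := Real.one_lt_rpow h2 hε
  nlinarith [hν k]

/-- The shell between two regions lies in the corresponding shell of the orthant, whose volume is
explicit. This gives a modulus of continuity even after the cube starts to cut the region. -/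
lemma regionVolume_sub_le (hK : 1 ≤ K) (hε : 0 < ε) (hν : ∀ k, 0 < ν k) {v : ℝ} (hu : 0 ≤ u)
    (huv : u ≤ v) : regionVolume ν ε v - regionVolume ν ε u ≤
      orthantVolume ν ε * (v ^ ((K : ℝ) / ε) - u ^ ((K : ℝ) / ε)) := by
  have hsub : region ν ε u ⊆ region ν ε v := fun _ hx => ⟨hx.1, hx.2.trans huv⟩
  have hsub' : orthantBall ν ε u ⊆ orthantBall ν ε v := fun _ hx => ⟨hx.1, hx.2.trans huv⟩
  have h1 := measureReal_sdiff (μ := volume) hsub (measurableSet_region ν ε u)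
    (volume_ne_top_of_subset_unitCube (region_subset ν ε v))
  have h2 := measureReal_sdiff (μ := volume) hsub' (measurableSet_orthantBall ν ε u)
    (volume_orthantBall_ne_top hε hν v)
  rw [volume_orthantBall hK hε hν hu, volume_orthantBall hK hε hν (hu.trans huv), ← mul_sub] at h2
  rw [regionVolume_eq, regionVolume_eq, ← h1, ← h2]
  refine measureReal_mono ?_ (measure_ne_top_of_subset Set.sdiff_subset
    (volume_orthantBall_ne_top hε hν v))
  rintro x ⟨hx1, hx2⟩
  exact ⟨⟨hx1.1.1, hx1.2⟩, fun h => hx2 ⟨hx1.1, h.2⟩⟩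

lemma regionVolume_zero (hK : 1 ≤ K) (hν : ∀ k, 0 < ν k) :
    regionVolume ν ε 0 = 0 := by
  rw [regionVolume_eq, Measure.real,
    measure_mono_null region_subset_orthantBall (volume_orthantBall_zero hK hν)]
  rfl

lemma continuousOn_regionVolume (hK : 1 ≤ K) (hε : 0 < ε) (hν : ∀ k, 0 < ν k) :
    ContinuousOn (regionVolume ν ε) (Set.Ici 0) := by
  have hp : 0 ≤ (K : ℝ) / ε := by positivity
  have hc : Continuous fun u : ℝ => orthantVolume ν ε * u ^ ((K : ℝ) / ε) :=
    continuous_const.mul (Real.continuous_rpow_const hp)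
  intro u hu
  have h1 : Tendsto (fun v : ℝ => |orthantVolume ν ε * v ^ ((K : ℝ) / ε) -
      orthantVolume ν ε * u ^ ((K : ℝ) / ε)|) (𝓝[Set.Ici 0] u) (𝓝 0) := by
    have := ((hc.sub continuous_const).abs).tendsto' (f := fun v : ℝ =>
      |orthantVolume ν ε * v ^ ((K : ℝ) / ε) - orthantVolume ν ε * u ^ ((K : ℝ) / ε)|) u 0
      (by simp)
    exact this.mono_left nhdsWithin_le_nhds
  rw [ContinuousWithinAt, tendsto_iff_dist_tendsto_zero]
  refine squeeze_zero' (Eventually.of_forall fun _ => dist_nonneg) ?_ h1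
  filter_upwards [self_mem_nhdsWithin] with v hv
  rw [Real.dist_eq, ← mul_sub]
  rcases le_total u v with huv | huv
  · rw [abs_of_nonneg (sub_nonneg.2 (regionVolume_mono ν ε huv))]
    exact (regionVolume_sub_le hK hε hν hu huv).trans (le_abs_self _)
  · rw [abs_sub_comm, abs_of_nonneg (sub_nonneg.2 (regionVolume_mono ν ε huv))]
    refine (regionVolume_sub_le hK hε hν hv huv).trans (le_trans (le_abs_self _) (le_of_eq ?_))
    rw [← abs_neg]
    congr 1
    ring

/-- The set of points of the cube whose score is at most `t`. -/
def scoreSet (ν : Fin K → ℝ) (ε t : ℝ) : Set (Fin K → ℝ) :=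
  {x | x ∈ unitCube K ∧ regionVolume ν ε (weightedPow ν ε x) ≤ t}

lemma measurable_score (ν : Fin K → ℝ) (ε : ℝ) :
    Measurable fun x => regionVolume ν ε (weightedPow ν ε x) :=
  (regionVolume_mono ν ε).measurable.comp (measurable_weightedPow ν ε)

lemma measurableSet_scoreSet (ν : Fin K → ℝ) (ε t : ℝ) : MeasurableSet (scoreSet ν ε t) :=
  (measurableSet_unitCube K).inter (measurableSet_le (measurable_score ν ε) measurable_const)

lemma scoreSet_subset (ν : Fin K → ℝ) (ε t : ℝ) : scoreSet ν ε t ⊆ unitCube K := fun _ hx => hx.1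

lemma scoreSet_mono (ν : Fin K → ℝ) (ε : ℝ) {t t' : ℝ} (h : t ≤ t') :
    scoreSet ν ε t ⊆ scoreSet ν ε t' := fun _ hx => ⟨hx.1, hx.2.trans h⟩

/-- Take the largest `u` in `[0, ∑ νₖ]` with `h(u) ≤ t`: it exists by continuity and compactness,
and the intermediate value theorem forces `h(u) = t`. Strict monotonicity of `h` is not needed. -/
lemma exists_scoreSet_eq_region (hK : 1 ≤ K) (hε : 0 < ε) (hν : ∀ k, 0 < ν k) {t : ℝ}
    (ht : t ∈ Set.Icc (0 : ℝ) 1) :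
    ∃ u, regionVolume ν ε u = t ∧ scoreSet ν ε t = region ν ε u := by
  have hM : 0 ≤ ∑ k, ν k := Finset.sum_nonneg fun k _ => (hν k).le
  have hcont := (continuousOn_regionVolume hK hε hν).mono
    (Set.Icc_subset_Ici_self (b := (0 : ℝ)) (a := ∑ k, ν k))
  have hclosed : IsClosed (Set.Icc 0 (∑ k, ν k) ∩ regionVolume ν ε ⁻¹' Set.Iic t) :=
    hcont.preimage_isClosed_of_isClosed isClosed_Icc isClosed_Iic
  have hcomp : IsCompact (Set.Icc 0 (∑ k, ν k) ∩ regionVolume ν ε ⁻¹' Set.Iic t) :=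
    isCompact_Icc.of_isClosed_subset hclosed Set.inter_subset_left
  obtain ⟨u, hu, hmax⟩ := hcomp.exists_isGreatest
    ⟨0, ⟨le_rfl, hM⟩, (regionVolume_zero hK hν).trans_le ht.1⟩
  have hut : regionVolume ν ε u ≤ t := hu.2
  refine ⟨u, hut.antisymm ?_, ?_⟩
  · obtain ⟨v, hv, hvt⟩ := intermediate_value_Icc hu.1.2
      (hcont.mono (Set.Icc_subset_Icc_left hu.1.1))
      ⟨hut, ht.2.trans_eq (regionVolume_sum hε hν).symm⟩
    rw [← hvt]
    exact regionVolume_mono ν ε (hmax ⟨⟨hu.1.1.trans hv.1, hv.2⟩, hvt.le⟩)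
  · ext x
    refine and_congr_right fun hx => ⟨fun h => ?_, fun h => ?_⟩
    · exact hmax ⟨⟨weightedPow_nonneg (fun k => (hν k).le) hx.1, weightedPow_le_sum hε hν hx⟩, h⟩
    · exact (regionVolume_mono ν ε h).trans hut

/-- The score of a uniformly distributed point of the cube is uniformly distributed. -/
lemma volume_scoreSet (hK : 1 ≤ K) (hε : 0 < ε) (hν : ∀ k, 0 < ν k) {t : ℝ}
    (ht : t ∈ Set.Icc (0 : ℝ) 1) : volume.real (scoreSet ν ε t) = t := by
  obtain ⟨u, hu, hset⟩ := exists_scoreSet_eq_region hK hε hν ht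
  rw [hset, ← regionVolume_eq, hu]

lemma exists_pos_le (hν : ∀ k, 0 < ν k) : ∃ m > 0, ∀ k, m ≤ ν k := by
  by_cases hK : Nonempty (Fin K)
  · obtain ⟨k, hk⟩ := Finite.exists_min ν
    exact ⟨ν k, hν k, hk⟩
  · exact ⟨1, one_pos, fun k => absurd ⟨k⟩ hK⟩

/-- Below the smallest weight the cube constraint is inactive, so `h` is an explicit, strictly
increasing power. -/
lemma scoreSet_eq_orthantBall (hK : 1 ≤ K) (hε : 0 < ε) (hν : ∀ k, 0 < ν k) {m : ℝ}
    (hm : ∀ k, m ≤ ν k) (hu : 0 ≤ u) (hum : u < m) :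
    scoreSet ν ε (orthantVolume ν ε * u ^ ((K : ℝ) / ε)) = orthantBall ν ε u := by
  have hp : 0 < (K : ℝ) / ε := by
    have : (0 : ℝ) < K := by exact_mod_cast hK
    positivity
  have hvol : ∀ v, 0 ≤ v → v ≤ m →
      regionVolume ν ε v = orthantVolume ν ε * v ^ ((K : ℝ) / ε) := fun v hv hvm => by
    rw [regionVolume_eq, region_eq_orthantBall hε hν fun k => hvm.trans (hm k),
      volume_orthantBall hK hε hν hv]
  rw [← region_eq_orthantBall hε hν fun k => hum.le.trans (hm k), ← hvol u hu hum.le]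
  ext x
  refine and_congr_right fun hx => ⟨fun h => ?_, fun h => regionVolume_mono ν ε h⟩
  by_contra! h1
  -- The weighted sum may exceed `m`, where the explicit formula fails; truncating at `m` keeps the
  -- comparison within its range.
  have h2 : u < min (weightedPow ν ε x) m := lt_min h1 hum
  have h3 := (regionVolume_mono ν ε (min_le_left (weightedPow ν ε x) m)).trans h
  rw [hvol _ (hu.trans h2.le) (min_le_right _ _), hvol u hu hum.le] at h3
  exact absurd h3 (not_le.2 (mul_lt_mul_of_pos_left (Real.rpow_lt_rpow hu h2 hp)
    (orthantVolume_pos hK hε hν)))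

end Score

/-! ### The score cdf under false nulls -/

section Cdf

variable {K : ℕ} {g : (Fin K → ℝ) → ℝ} {ν γ : Fin K → ℝ} {ε : ℝ}

/-- The cdf of the score of a point with density `g`. -/
def scoreCdf (g : (Fin K → ℝ) → ℝ) (ν : Fin K → ℝ) (ε t : ℝ) : ℝ := ∫ x in scoreSet ν ε t, g x

lemma IsPeakedDensity.integrableOn (hg : IsPeakedDensity g) : IntegrableOn g (unitCube K) :=
  hg.continuousOn.integrableOn_compact isCompact_Icc

lemma IsPeakedDensity.le_zero (hg : IsPeakedDensity g) {x : Fin K → ℝ} (hx : x ∈ unitCube K) :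
    g x ≤ g 0 := by
  by_cases h : x = 0
  · rw [h]
  · exact (hg.lt_zero x hx h).le

lemma IsPeakedDensity.integrableOn_sub (hg : IsPeakedDensity g) {S : Set (Fin K → ℝ)}
    (hS : S ⊆ unitCube K) : IntegrableOn (fun x => g 0 - g x) S :=
  (integrableOn_const (volume_ne_top_of_subset_unitCube hS)).sub (hg.integrableOn.mono_set hS)

/-- Uniformity of the score turns `g(0) t` into the integral of `g(0)` over the score set, so the
deficit is the integral of a nonnegative function over a growing set. The properties of the cdf
relative to its tangent all come from this. -/
lemma IsPeakedDensity.mul_sub_scoreCdf (hg : IsPeakedDensity g) (hK : 1 ≤ K) (hε : 0 < ε)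
    (hν : ∀ k, 0 < ν k) {t : ℝ} (ht : t ∈ Set.Icc (0 : ℝ) 1) :
    g 0 * t - scoreCdf g ν ε t = ∫ x in scoreSet ν ε t, (g 0 - g x) := by
  have hc : IntegrableOn (fun _ : Fin K → ℝ => g 0) (scoreSet ν ε t) :=
    integrableOn_const (volume_ne_top_of_subset_unitCube (scoreSet_subset ν ε t))
  rw [integral_sub hc
    (hg.integrableOn.mono_set (scoreSet_subset ν ε t)), setIntegral_const,
    volume_scoreSet hK hε hν ht, smul_eq_mul, mul_comm, scoreCdf]

lemma IsPeakedDensity.scoreCdf_sub_le (hg : IsPeakedDensity g) (hK : 1 ≤ K) (hε : 0 < ε)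
    (hν : ∀ k, 0 < ν k) {x y : ℝ} (hx : x ∈ Set.Icc (0 : ℝ) 1) (hy : y ∈ Set.Icc (0 : ℝ) 1)
    (hxy : x ≤ y) : scoreCdf g ν ε y - scoreCdf g ν ε x ≤ g 0 * (y - x) := by
  have h1 : ∫ z in scoreSet ν ε x, (g 0 - g z) ≤ ∫ z in scoreSet ν ε y, (g 0 - g z) := by
    refine setIntegral_mono_set (hg.integrableOn_sub (scoreSet_subset ν ε y)) ?_
      (scoreSet_mono ν ε hxy).eventuallyLE
    filter_upwards [ae_restrict_mem (measurableSet_scoreSet ν ε y)] with z hz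
    exact sub_nonneg.2 (hg.le_zero hz.1)
  rw [← hg.mul_sub_scoreCdf hK hε hν hx, ← hg.mul_sub_scoreCdf hK hε hν hy] at h1
  linarith

/-- The integrand `g(0) - g` is positive off the origin, a null set since `K ≥ 1`, and the score set
has volume `t > 0`. -/
lemma IsPeakedDensity.scoreCdf_lt (hg : IsPeakedDensity g) (hK : 1 ≤ K) (hε : 0 < ε)
    (hν : ∀ k, 0 < ν k) {t : ℝ} (ht : t ∈ Set.Ioc (0 : ℝ) 1) :
    scoreCdf g ν ε t < g 0 * t := by
  have : Nonempty (Fin K) := ⟨⟨0, hK⟩⟩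
  have ht' : t ∈ Set.Icc (0 : ℝ) 1 := Set.Ioc_subset_Icc_self ht
  rw [← sub_pos, hg.mul_sub_scoreCdf hK hε hν ht', setIntegral_pos_iff_support_of_nonneg_ae]
  · have hsub : scoreSet ν ε t \ {0} ⊆
        (Function.support fun x => g 0 - g x) ∩ scoreSet ν ε t := by
      rintro x ⟨hx, hx0⟩
      exact ⟨(sub_pos.2 (hg.lt_zero x hx.1 hx0)).ne', hx⟩
    refine lt_of_lt_of_le ?_ (measure_mono hsub)
    rw [measure_sdiff_null (measure_singleton _)]
    refine pos_iff_ne_zero.2 fun h0 => ?_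
    have := volume_scoreSet hK hε hν ht'
    rw [Measure.real, h0, ENNReal.toReal_zero] at this
    exact ht.1.ne this
  · filter_upwards [ae_restrict_mem (measurableSet_scoreSet ν ε t)] with z hz
    exact sub_nonneg.2 (hg.le_zero hz.1)
  · exact hg.integrableOn_sub (scoreSet_subset ν ε t)

/-- The slope at `0` is read off from the deficit tending to `0`, which explains the rate
hypothesis. -/
lemma IsPeakedDensity.isPeakedCdf (hg : IsPeakedDensity g) (hK : 1 ≤ K) (hε : 0 < ε)
    (hν : ∀ k, 0 < ν k) {d L : ℝ} (hd : 0 < d)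
    (hrate : HasDeficitRate (g 0) (scoreCdf g ν ε) d L) :
    IsPeakedCdf (g 0) (scoreCdf g ν ε) where
  zero := by
    have h0 : volume.real (scoreSet ν ε 0) = 0 := volume_scoreSet hK hε hν ⟨le_rfl, zero_le_one⟩
    have h1 : volume (scoreSet ν ε 0) = 0 :=
      (measureReal_eq_zero_iff (volume_ne_top_of_subset_unitCube (scoreSet_subset ν ε 0))).1 h0
    rw [scoreCdf, Measure.restrict_eq_zero.2 h1, integral_zero_measure]
  one := by
    have : scoreSet ν ε 1 = unitCube K :=
      (scoreSet_subset ν ε 1).antisymm fun x hx => ⟨hx, (regionVolume_mem ν ε _).2⟩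
    rw [scoreCdf, this, hg.integral_eq_one]
  mono x _ y _ hxy := by
    refine setIntegral_mono_set (hg.integrableOn.mono_set (scoreSet_subset ν ε y)) ?_
      (scoreSet_mono ν ε hxy).eventuallyLE
    filter_upwards [ae_restrict_mem (measurableSet_scoreSet ν ε y)] with z hz
    exact hg.nonneg z hz.1
  sub_le x hx y hy hxy := hg.scoreCdf_sub_le hK hε hν hx hy hxy
  lt t ht := hg.scoreCdf_lt hK hε hν ht
  slope := by
    have h1 := (tendsto_const_nhds (x := g 0)).sub (hrate.tendsto_zero hd)
    rw [sub_zero] at h1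
    refine h1.congr' ?_
    filter_upwards [self_mem_nhdsWithin] with t ht
    have ht0 : (0 : ℝ) < t := ht
    rw [deficit]
    field_simp
    ring

end Cdf

/-! ### The rate of the deficit, from the expansion of the density -/

/-- The tangent line inequality for `v ↦ v ^ (1 + d)`. -/
lemma rpow_one_add_sub_ge {d u v : ℝ} (hd : 0 < d) (hu : 0 < u) (huv : u ≤ v) :
    (1 + d) * u ^ d * (v - u) ≤ v ^ (1 + d) - u ^ (1 + d) := by
  have h1 := one_add_mul_self_le_rpow_one_add (s := v / u - 1) (p := 1 + d)
    (by have := div_nonneg (hu.le.trans huv) hu.le; linarith) (by linarith)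
  rw [add_sub_cancel, Real.div_rpow (hu.le.trans huv) hu.le,
    le_div_iff₀ (Real.rpow_pos_of_pos hu _)] at h1
  have h2 : u ^ (1 + d) = u * u ^ d := by
    rw [Real.rpow_add hu, Real.rpow_one]
  have h3 : (1 + (1 + d) * (v / u - 1)) * u ^ (1 + d) =
      u ^ (1 + d) + (1 + d) * u ^ d * (v - u) := by
    rw [h2]
    field_simp
  linarith

/-- If the increments of `b t - F₁(t)` are asymptotic to those of `L t ^ (1 + d)` near `0`, then
the deficit has the rate `L t ^ d`. -/
lemma hasDeficitRate_of_increments {b d L : ℝ} {F₁ : ℝ → ℝ} (hd : 0 < d) (hL : 0 < L)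
    (h0 : F₁ 0 = 0)
    (h : ∀ e > 0, ∃ δ > 0, ∀ u v, 0 ≤ u → u ≤ v → v ≤ δ →
      |(b * v - F₁ v) - (b * u - F₁ u) - L * (v ^ (1 + d) - u ^ (1 + d))| ≤
        e * (v ^ (1 + d) - u ^ (1 + d))) : HasDeficitRate b F₁ d L := by
  have h0' : b * 0 - F₁ 0 = 0 := by rw [h0]; ring
  have hz : (0 : ℝ) ^ (1 + d) = 0 := Real.zero_rpow (by linarith)
  have hpow : ∀ {t : ℝ}, 0 < t → t ^ (1 + d) = t * t ^ d := fun ht => by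
    rw [Real.rpow_add ht, Real.rpow_one]
  constructor
  · have he : 0 < L * d / (2 * (2 + d)) := by positivity
    set e := L * d / (2 * (2 + d)) with hedef
    have hLe : L + e < (L - e) * (1 + d) := by
      have h1 : e * (2 * (2 + d)) = L * d := by rw [hedef]; field_simp
      have h2 : 0 < L * d := by positivity
      nlinarith
    obtain ⟨δ, hδ, hinc⟩ := h e he
    refine ⟨min δ (1 / 2), ⟨by positivity, (min_le_right _ _).trans_lt (by norm_num)⟩, ?_⟩
    intro u hu v hv huv
    have hu0 : 0 < u := hu.1
    have hv0 : 0 < v := hv.1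
    have h1 := (abs_le.1 (hinc u v hu0.le huv.le (hv.2.trans (min_le_left _ _)))).1
    have h2 := (abs_le.1 (hinc 0 u le_rfl hu0.le (hu.2.trans (min_le_left _ _)))).2
    rw [h0', hz, sub_zero, sub_zero, hpow hu0] at h2
    have h3 := rpow_one_add_sub_ge hd hu0 huv.le
    have hud : 0 < u ^ d := Real.rpow_pos_of_pos hu0 d
    have hvu : 0 < v - u := sub_pos.2 huv
    have hX : 0 < u ^ d * (v - u) := mul_pos hud hvu
    have hLe0 : 0 ≤ L - e := by nlinarith
    have h4 : (L - e) * ((1 + d) * u ^ d * (v - u)) ≤ (b * v - F₁ v) - (b * u - F₁ u) := by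
      have := mul_le_mul_of_nonneg_left h3 hLe0
      linarith
    rw [deficit, deficit, div_lt_div_iff₀ hu0 hv0]
    have h5 : b * u - F₁ u ≤ (L + e) * (u * u ^ d) := by linarith
    have h6 : (b * u - F₁ u) * (v - u) ≤ (L + e) * (u * u ^ d) * (v - u) :=
      mul_le_mul_of_nonneg_right h5 hvu.le
    have h7 := mul_le_mul_of_nonneg_right h4 hu0.le
    have h8 := mul_lt_mul_of_pos_right hLe (mul_pos hX hu0)
    nlinarith
  · rw [Metric.tendsto_nhds]
    intro e he
    obtain ⟨δ, hδ, hinc⟩ := h (e / 2) (half_pos he)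
    filter_upwards [Ioo_mem_nhdsGT hδ] with t ht
    have ht0 := ht.1
    have htd : 0 < t ^ d := Real.rpow_pos_of_pos ht0 d
    have h1 := hinc 0 t le_rfl ht0.le ht.2.le
    rw [h0', hz, sub_zero, sub_zero, hpow ht0] at h1
    have h2 : deficit b F₁ t / t ^ d - L =
        (b * t - F₁ t - L * (t * t ^ d)) / (t * t ^ d) := by
      rw [deficit]; field_simp
    rw [Real.dist_eq, h2, abs_div, abs_of_pos (mul_pos ht0 htd), div_lt_iff₀ (mul_pos ht0 htd)]
    have := mul_pos he (mul_pos ht0 htd)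
    linarith

section Rate

variable {K : ℕ} {g : (Fin K → ℝ) → ℝ} {ν γ : Fin K → ℝ} {ε : ℝ}

/-- The expansion of `g` at the origin, with error relative to the weights `ν`. -/
lemma HasExpansion.exists_bound (hexp : HasExpansion g γ ε) (hε : 0 < ε)
    (hg0 : 0 < g 0) {m : ℝ} (hm0 : 0 < m) (hm : ∀ k, m ≤ ν k) {e : ℝ} (he : 0 < e) :
    ∃ u₀ > 0, u₀ < m ∧ ∀ x ∈ orthantBall ν ε u₀,
      |g 0 - g x - g 0 * weightedPow γ ε x| ≤ e * weightedPow ν ε x := by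
  have hν : ∀ k, 0 < ν k := fun k => hm0.trans_le (hm k)
  obtain ⟨r, hr, hgr⟩ := hexp
  -- Since `m ‖x‖ ^ ε` is at most the `ν`-weighted sum, a remainder below `(e m / g 0) ‖x‖ ^ ε`
  -- gives the error `e` after multiplication by `g 0`.
  have hc : 0 < e * m / g 0 := by positivity
  have h1 := hr.def hc
  rw [eventually_nhdsWithin_iff, Metric.eventually_nhds_iff] at h1
  obtain ⟨δ, hδ, h2⟩ := h1
  -- The first entry keeps the ball inside the cube; the second forces `‖x‖ ≤ δ / 2`.
  refine ⟨min (m / 2) (m * (δ / 2) ^ ε), by positivity,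
    (min_le_left _ _).trans_lt (half_lt_self hm0), fun x hx => ?_⟩
  have hum : min (m / 2) (m * (δ / 2) ^ ε) ≤ m :=
    (min_le_left _ _).trans (half_le_self hm0.le)
  have hxc : x ∈ unitCube K := by
    have := region_eq_orthantBall hε hν fun k => hum.trans (hm k)
    rw [← this] at hx
    exact hx.1
  have hW0 := weightedPow_nonneg (ε := ε) (fun k => (hν k).le) hx.1
  have hcoord : ∀ k, m * x k ^ ε ≤ weightedPow ν ε x := fun k =>
    (mul_le_mul_of_nonneg_right (hm k) (Real.rpow_nonneg (hx.1 k) _)).trans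
      (mul_rpow_le_weightedPow (fun k => (hν k).le) hx.1 k)
  have hnorm : ‖x‖ ≤ (weightedPow ν ε x / m) ^ (1 / ε) := by
    refine (pi_norm_le_iff_of_nonneg (by positivity)).2 fun k => ?_
    rw [Real.norm_of_nonneg (hx.1 k)]
    calc x k = (x k ^ ε) ^ (1 / ε) := by
          rw [← Real.rpow_mul (hx.1 k), mul_one_div_cancel hε.ne', Real.rpow_one]
      _ ≤ _ := by
          refine Real.rpow_le_rpow (Real.rpow_nonneg (hx.1 k) _) ?_ (by positivity)
          rw [le_div_iff₀ hm0, mul_comm]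
          exact hcoord k
  have hpow : ‖x‖ ^ ε ≤ weightedPow ν ε x / m := by
    calc ‖x‖ ^ ε ≤ ((weightedPow ν ε x / m) ^ (1 / ε)) ^ ε :=
          Real.rpow_le_rpow (norm_nonneg _) hnorm hε.le
      _ = _ := by rw [← Real.rpow_mul (by positivity), one_div_mul_cancel hε.ne', Real.rpow_one]
  have hdist : dist x 0 < δ := by
    rw [dist_zero_right]
    have h3 : ‖x‖ ^ ε ≤ (δ / 2) ^ ε := by
      refine hpow.trans ?_
      rw [div_le_iff₀ hm0, mul_comm]
      exact hx.2.trans (min_le_right _ _)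
    have h4 : ‖x‖ ≤ δ / 2 := (Real.rpow_le_rpow_iff (norm_nonneg _) (by positivity) hε).1 h3
    linarith
  have h3 := h2 hdist hxc
  rw [Real.norm_eq_abs, Real.norm_of_nonneg (by positivity)] at h3
  have h4 : g 0 - g x - g 0 * weightedPow γ ε x = -(g 0 * r x) := by
    rw [hgr x hxc]; ring
  rw [h4, abs_neg, abs_mul, abs_of_pos hg0]
  calc g 0 * |r x| ≤ g 0 * (e * m / g 0 * (weightedPow ν ε x / m)) := by
        gcongr
        exact h3.trans (mul_le_mul_of_nonneg_left hpow hc.le)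
    _ = e * weightedPow ν ε x := by field_simp

/-- The rate constant of the deficit of the score with weights `ν`. -/
def deficitConst (g : (Fin K → ℝ) → ℝ) (γ : Fin K → ℝ) (ε : ℝ) (ν : Fin K → ℝ) : ℝ :=
  g 0 * ((∑ k, γ k / ν k) / (K + ε)) / orthantVolume ν ε ^ (ε / K)

lemma IsPeakedDensity.zero_pos (hg : IsPeakedDensity g) : 0 < g 0 := by
  by_contra! h
  have h1 : ∫ x in unitCube K, g x = 0 := by
    refine setIntegral_eq_zero_of_forall_eq_zero fun x hx => ?_
    exact le_antisymm ((hg.le_zero hx).trans h) (hg.nonneg x hx)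
  rw [hg.integral_eq_one] at h1
  exact one_ne_zero h1

lemma deficitConst_pos (hK : 1 ≤ K) (hε : 0 < ε) (hg : IsPeakedDensity g) (hγ : ∀ k, 0 < γ k)
    (hν : ∀ k, 0 < ν k) : 0 < deficitConst g γ ε ν := by
  have : Nonempty (Fin K) := ⟨⟨0, hK⟩⟩
  have h1 := hg.zero_pos
  have h2 := orthantVolume_pos hK hε hν
  have h3 : 0 < ∑ k, γ k / ν k :=
    Finset.sum_pos (fun k _ => div_pos (hγ k) (hν k)) Finset.univ_nonempty
  unfold deficitConst
  positivity

/-- Both differences are integrals over `T \ S`. A pointwise bound thus controls increments, as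
monotonicity of the deficit requires. -/
lemma abs_setIntegral_sub_le {S T : Set (Fin K → ℝ)} (hST : S ⊆ T) (hS : MeasurableSet S)
    (hT : MeasurableSet T) {f w : (Fin K → ℝ) → ℝ} (hf : IntegrableOn f T) (hw : IntegrableOn w T)
    (h : ∀ x ∈ T, |f x| ≤ w x) :
    |(∫ x in T, f x) - ∫ x in S, f x| ≤ (∫ x in T, w x) - ∫ x in S, w x := by
  rw [← setIntegral_sdiff hS hf hST, ← setIntegral_sdiff hS hw hST]
  refine (abs_integral_le_integral_abs).trans ?_
  refine setIntegral_mono_on (hf.mono_set Set.sdiff_subset).abs (hw.mono_set Set.sdiff_subset)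
    (hT.diff hS) fun x hx => h x hx.1

/-- For small `t` the score set is the orthant ball of level `U t = (t / V) ^ (ε / K)`. The leading
part of `g(0) - g` integrates over it to exactly `L t ^ (1 + ε / K)`, and the remainder over a shell
is dominated by the same integral with weights `ν`. -/
lemma hasDeficitRate_scoreCdf (hK : 1 ≤ K) (hε : 0 < ε) (hg : IsPeakedDensity g)
    (hγ : ∀ k, 0 < γ k) (hν : ∀ k, 0 < ν k) (hexp : HasExpansion g γ ε) :
    HasDeficitRate (g 0) (scoreCdf g ν ε) (ε / K) (deficitConst g γ ε ν) := by
  have hK' : (0 : ℝ) < K := by exact_mod_cast hK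
  have hd : 0 < ε / K := by positivity
  have hV := orthantVolume_pos hK hε hν
  have hg0 := hg.zero_pos
  obtain ⟨m, hm0, hm⟩ := exists_pos_le hν
  have hzero : scoreCdf g ν ε 0 = 0 := by
    have h0 : volume.real (scoreSet ν ε 0) = 0 := volume_scoreSet hK hε hν ⟨le_rfl, zero_le_one⟩
    have h1 : volume (scoreSet ν ε 0) = 0 :=
      (measureReal_eq_zero_iff (volume_ne_top_of_subset_unitCube (scoreSet_subset ν ε 0))).1 h0
    rw [scoreCdf, Measure.restrict_eq_zero.2 h1, integral_zero_measure]
  refine hasDeficitRate_of_increments hd (deficitConst_pos hK hε hg hγ hν) hzero fun e he => ?_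
  set V := orthantVolume ν ε with hVdef
  have hVd : 0 < V ^ (ε / K) := Real.rpow_pos_of_pos hV _
  -- The `ν`-weighted sum integrates to `t ^ (1 + ε / K) / V ^ (ε / K) * (K / (K + ε))`; this
  -- pointwise tolerance cancels those factors and leaves `e`.
  have hc : 0 < e * V ^ (ε / K) * ((K + ε) / K) := by positivity
  obtain ⟨u₀, hu₀, hu₀m, hbound⟩ := hexp.exists_bound hε hg0 hm0 hm hc
  have hp : 0 < (K : ℝ) / ε := by positivity
  refine ⟨min 1 (V * u₀ ^ ((K : ℝ) / ε)), by positivity, fun t t' ht htt' ht' => ?_⟩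
  let U : ℝ → ℝ := fun t => (t / V) ^ (ε / K)
  have hU0 : ∀ t, 0 ≤ t → 0 ≤ U t := fun t ht => Real.rpow_nonneg (div_nonneg ht hV.le) _
  have hUt : ∀ t, 0 ≤ t → V * U t ^ ((K : ℝ) / ε) = t := fun t ht => by
    have h1 : ε / K * (K / ε) = 1 := by field_simp
    simp only [U]
    rw [← Real.rpow_mul (div_nonneg ht hV.le), h1, Real.rpow_one]
    field_simp
  have hUle : ∀ t, 0 ≤ t → t ≤ V * u₀ ^ ((K : ℝ) / ε) → U t ≤ u₀ := fun t ht h => by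
    rw [← hUt t ht] at h
    exact (Real.rpow_le_rpow_iff (hU0 t ht) hu₀.le hp).1 (le_of_mul_le_mul_left h hV)
  have hball : ∀ t, 0 ≤ t → t ≤ V * u₀ ^ ((K : ℝ) / ε) →
      scoreSet ν ε t = orthantBall ν ε (U t) := fun t ht h => by
    have := scoreSet_eq_orthantBall hK hε hν hm (hU0 t ht) ((hUle t ht h).trans_lt hu₀m)
    rwa [← hVdef, hUt t ht] at this
  have hpowU : ∀ t, 0 ≤ t → V * (U t ^ ((K : ℝ) / ε) * U t) =
      t ^ (1 + ε / K) / V ^ (ε / K) := fun t ht => by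
    rw [← mul_assoc, hUt t ht]
    simp only [U]
    rw [Real.div_rpow ht hV.le, Real.rpow_add_of_nonneg ht zero_le_one hd.le, Real.rpow_one]
    ring
  have ht'0 := ht.trans htt'
  have ht'1 : t' ≤ 1 := ht'.trans (min_le_left _ _)
  have ht'V := ht'.trans (min_le_right _ _)
  have htV := htt'.trans ht'V
  have hdef : ∀ t ∈ Set.Icc (0 : ℝ) 1, t ≤ V * u₀ ^ ((K : ℝ) / ε) →
      g 0 * t - scoreCdf g ν ε t =
        (∫ x in orthantBall ν ε (U t), (g 0 - g x - g 0 * weightedPow γ ε x)) +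
          deficitConst g γ ε ν * t ^ (1 + ε / K) := by
    intro t ht htV
    have hsub : orthantBall ν ε (U t) ⊆ unitCube K := hball t ht.1 htV ▸ scoreSet_subset ν ε t
    rw [hg.mul_sub_scoreCdf hK hε hν ht, hball t ht.1 htV,
      integral_sub (hg.integrableOn_sub hsub) ((integrableOn_weightedPow γ hε hν _).const_mul _),
      integral_const_mul, integral_weightedPow hK hε hν γ (hU0 t ht.1), ← hVdef,
      hpowU t ht.1, deficitConst, ← hVdef]
    ring
  have hsub' : orthantBall ν ε (U t') ⊆ unitCube K := hball t' ht'0 ht'V ▸ scoreSet_subset ν ε t'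
  have hUmono : U t ≤ U t' := Real.rpow_le_rpow (div_nonneg ht hV.le) (by gcongr) hd.le
  have key := abs_setIntegral_sub_le (S := orthantBall ν ε (U t)) (T := orthantBall ν ε (U t'))
    (f := fun x => g 0 - g x - g 0 * weightedPow γ ε x)
    (w := fun x => e * V ^ (ε / K) * ((K + ε) / K) * weightedPow ν ε x)
    (fun x hx => ⟨hx.1, hx.2.trans hUmono⟩)
    (measurableSet_orthantBall _ _ _) (measurableSet_orthantBall _ _ _)
    ((hg.integrableOn_sub hsub').sub ((integrableOn_weightedPow γ hε hν _).const_mul _))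
    ((integrableOn_weightedPow ν hε hν _).const_mul _)
    (fun x hx => hbound x ⟨hx.1, hx.2.trans (hUle t' ht'0 ht'V)⟩)
  have hone : ∑ k, ν k / ν k = K := by
    simp [fun k => div_self (hν k).ne']
  rw [integral_const_mul, integral_const_mul, integral_weightedPow hK hε hν ν (hU0 t ht),
    integral_weightedPow hK hε hν ν (hU0 t' ht'0), ← hVdef, hpowU t ht, hpowU t' ht'0, hone] at key
  rw [hdef t ⟨ht, htt'.trans ht'1⟩ htV, hdef t' ⟨ht'0, ht'1⟩ ht'V]
  refine le_trans (le_of_eq ?_) (key.trans (le_of_eq ?_))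
  · congr 1
    ring
  · field_simp

end Rate

/-! ### Evaluation and maximization of the power constant -/

section PowerConst

variable {K : ℕ} {ν γ : Fin K → ℝ} {ε : ℝ}

lemma geomMean_pos (hν : ∀ k, 0 < ν k) : 0 < geomMean ν :=
  Real.rpow_pos_of_pos (Finset.prod_pos fun k _ => hν k) _

lemma geomMean_eq_prod (hν : ∀ k, 0 ≤ ν k) : geomMean ν = ∏ k, ν k ^ (1 / (K : ℝ)) := by
  rw [geomMean, Real.finsetProd_rpow _ _ fun k _ => hν k]

lemma geomMean_div (hν : ∀ k, 0 < ν k) (hγ : ∀ k, 0 < γ k) :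
    geomMean (fun k => γ k / ν k) = geomMean γ / geomMean ν := by
  rw [geomMean, Finset.prod_div_distrib, Real.div_rpow (Finset.prod_nonneg fun k _ => (hγ k).le)
    (Finset.prod_nonneg fun k _ => (hν k).le)]
  rfl

lemma sum_geomMean_mul_div (ν γ : Fin K → ℝ) :
    ∑ k, geomMean ν * γ k / ν k = geomMean ν * ∑ k, γ k / ν k := by
  rw [Finset.mul_sum]
  exact Finset.sum_congr rfl fun k _ => mul_div_assoc _ _ _

/-- AM-GM for the ratios `γₖ / νₖ`, whose geometric mean is the quotient of the two geometric means.
-/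
lemma geomMean_le_mean (hK : 1 ≤ K) (hν : ∀ k, 0 < ν k) (hγ : ∀ k, 0 < γ k) :
    K * geomMean γ ≤ ∑ k, geomMean ν * γ k / ν k := by
  have hK' : (0 : ℝ) < K := by exact_mod_cast hK
  have hz : ∀ k, 0 < γ k / ν k := fun k => div_pos (hγ k) (hν k)
  have h := Real.geom_mean_le_arith_mean_weighted Finset.univ (fun _ : Fin K => 1 / (K : ℝ))
    (fun k => γ k / ν k) (fun _ _ => by positivity) (by simp; field_simp) fun k _ => (hz k).le
  rw [← geomMean_eq_prod fun k => (hz k).le, geomMean_div hν hγ, ← Finset.mul_sum,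
    div_le_iff₀ (geomMean_pos hν)] at h
  rw [sum_geomMean_mul_div]
  calc K * geomMean γ ≤ K * (1 / K * (∑ k, γ k / ν k) * geomMean ν) := by gcongr
    _ = _ := by field_simp

/-- Equality in AM-GM means that all ratios `γₖ / νₖ` coincide with their mean; `c` is the inverse
of that mean. -/
lemma geomMean_eq_mean_iff (hK : 1 ≤ K) (hν : ∀ k, 0 < ν k) (hγ : ∀ k, 0 < γ k) :
    K * geomMean γ = ∑ k, geomMean ν * γ k / ν k ↔ ∃ c : ℝ, 0 < c ∧ ν = c • γ := by
  have hK' : (0 : ℝ) < K := by exact_mod_cast hK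
  have hz : ∀ k, 0 < γ k / ν k := fun k => div_pos (hγ k) (hν k)
  have h := Real.geom_mean_eq_arith_mean_weighted_iff_of_pos' Finset.univ
    (fun _ : Fin K => 1 / (K : ℝ)) (fun k => γ k / ν k) (fun _ _ => by positivity)
    (by simp; field_simp) fun k _ => (hz k).le
  rw [← geomMean_eq_prod fun k => (hz k).le, geomMean_div hν hγ, ← Finset.mul_sum,
    div_eq_iff (geomMean_pos hν).ne'] at h
  have h1 : (K * geomMean γ = ∑ k, geomMean ν * γ k / ν k) ↔
      geomMean γ = 1 / K * (∑ k, γ k / ν k) * geomMean ν := by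
    rw [sum_geomMean_mul_div]
    constructor
    · intro h
      field_simp
      linarith
    · intro h
      rw [h]
      field_simp
  rw [h1, h]
  constructor
  · intro hall
    have : Nonempty (Fin K) := ⟨⟨0, hK⟩⟩
    have hpos : 0 < 1 / (K : ℝ) * ∑ k, γ k / ν k :=
      mul_pos (by positivity) (Finset.sum_pos (fun k _ => hz k) Finset.univ_nonempty)
    refine ⟨(1 / (K : ℝ) * ∑ k, γ k / ν k)⁻¹, inv_pos.2 hpos, ?_⟩
    funext k
    have h2 := hall k (Finset.mem_univ k)
    have := hν k
    rw [Pi.smul_apply, smul_eq_mul, ← h2]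
    have := hγ k
    field_simp
  · rintro ⟨c, hc, rfl⟩ k _
    have h2 : ∀ k, γ k / (c • γ) k = 1 / c := fun k => by
      have := hγ k
      simp only [Pi.smul_apply, smul_eq_mul]
      field_simp
    simp only [h2]
    simp
    field_simp

lemma orthantVolume_eq (hν : ∀ k, 0 < ν k) :
    orthantVolume ν ε = ballVolume K ε * (1 / geomMean ν) ^ ((K : ℝ) / ε) := by
  rcases Nat.eq_zero_or_pos K with rfl | hK
  · simp [orthantVolume]
  have hK' : (0 : ℝ) < K := by exact_mod_cast hK
  have hP : 0 ≤ ∏ k, ν k := Finset.prod_nonneg fun k _ => (hν k).le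
  rw [orthantVolume, mul_comm, Real.finsetProd_rpow _ _ fun k _ => (hν k).le, one_div (geomMean ν),
    Real.inv_rpow (geomMean_pos hν).le, geomMean, ← Real.rpow_mul hP]
  congr 3
  field_simp

variable {a : ℝ} {g : (Fin K → ℝ) → ℝ}

/-- The exponent `K / ε` turns the factor `V ^ (ε / K)` of the rate constant into `V = V_ε ν̄ ^ (-K
/ ε)`, which accounts for both `V_ε` and the `ν̄` inside the sum. -/
lemma powerConst_eq_deficitConst (hK : 1 ≤ K) (ha0 : 0 < a) (hε : 0 < ε)
    (hg : 0 < g 0) (hγ : ∀ k, 0 < γ k) (hν : ∀ k, 0 < ν k) {κ : ℝ} (hκ : alphaStar a g = κ)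
    (hκ0 : 0 < κ) :
    powerConst a g γ ε ν =
      g 0 * (1 / (a * κ ^ 2 * deficitConst g γ ε ν)) ^ (1 / (ε / K)) := by
  have hK' : (0 : ℝ) < K := by exact_mod_cast hK
  have : Nonempty (Fin K) := ⟨⟨0, hK⟩⟩
  have hV := orthantVolume_pos hK hε hν
  have hS : 0 < ∑ k, γ k / ν k :=
    Finset.sum_pos (fun k _ => div_pos (hγ k) (hν k)) Finset.univ_nonempty
  have hG := geomMean_pos hν
  have hVd : 0 < orthantVolume ν ε ^ (ε / K) := Real.rpow_pos_of_pos hV _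
  have h1 : 1 / (a * κ ^ 2 * deficitConst g γ ε ν) =
      (K + ε) / (a * κ ^ 2 * g 0) / (∑ k, γ k / ν k) * orthantVolume ν ε ^ (ε / K) := by
    rw [deficitConst]
    field_simp
  have h2 : (K + ε) / (a * κ ^ 2 * g 0) / (geomMean ν * ∑ k, γ k / ν k) =
      (K + ε) / (a * κ ^ 2 * g 0) / (∑ k, γ k / ν k) * (1 / geomMean ν) := by
    field_simp
  have h3 : ε / K * (K / ε) = 1 := by field_simp
  rw [powerConst, hκ, sum_geomMean_mul_div, h1, h2, one_div_div,
    Real.mul_rpow (by positivity) (by positivity), Real.mul_rpow (by positivity) hVd.le,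
    ← Real.rpow_mul hV.le, h3, Real.rpow_one, orthantVolume_eq hν]
  ring

lemma powerConst_pos (hK : 1 ≤ K) (hε : 0 < ε) (hg : 0 < g 0) (ha0 : 0 < a)
    (hκ0 : 0 < alphaStar a g) (hγ : ∀ k, 0 < γ k) (hν : ∀ k, 0 < ν k) :
    0 < powerConst a g γ ε ν := by
  have hK' : (0 : ℝ) < K := by exact_mod_cast hK
  have : Nonempty (Fin K) := ⟨⟨0, hK⟩⟩
  have hS : 0 < ∑ k, geomMean ν * γ k / ν k :=
    Finset.sum_pos (fun k _ => div_pos (mul_pos (geomMean_pos hν) (hγ k)) (hν k))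
      Finset.univ_nonempty
  have := ballVolume_pos hK hε
  unfold powerConst
  positivity

lemma sum_geomMean_self (hγ : ∀ k, 0 < γ k) : ∑ k, geomMean γ * γ k / γ k = K * geomMean γ := by
  simp [fun k => mul_div_cancel_right₀ (geomMean γ) (hγ k).ne']

/-- The weights `γ` maximize the power constant, uniquely up to scaling. -/
lemma powerConst_le (hK : 1 ≤ K) (hε : 0 < ε) (hg : 0 < g 0) (ha0 : 0 < a)
    (hκ0 : 0 < alphaStar a g) (hγ : ∀ k, 0 < γ k) (hν : ∀ k, 0 < ν k) :
    powerConst a g γ ε ν ≤ powerConst a g γ ε γ ∧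
      (powerConst a g γ ε ν = powerConst a g γ ε γ ↔ ∃ c : ℝ, 0 < c ∧ ν = c • γ) := by
  have hK' : (0 : ℝ) < K := by exact_mod_cast hK
  have hV := ballVolume_pos hK hε
  have hp : 0 < (K : ℝ) / ε := by positivity
  have hGγ := geomMean_pos hγ
  have hX : 0 < ((K : ℝ) + ε) / (a * alphaStar a g ^ 2 * g 0) := by positivity
  have hle := geomMean_le_mean hK hν hγ
  have hS : 0 < ∑ k, geomMean ν * γ k / ν k := (by positivity : 0 < K * geomMean γ).trans_le hle
  have hXS : 0 < ((K : ℝ) + ε) / (a * alphaStar a g ^ 2 * g 0) /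
      ∑ k, geomMean ν * γ k / ν k := div_pos hX hS
  constructor
  · unfold powerConst
    rw [sum_geomMean_self hγ]
    gcongr
  · rw [← geomMean_eq_mean_iff hK hν hγ, powerConst, powerConst, sum_geomMean_self hγ,
      mul_right_inj' (mul_pos hg hV).ne',
      Real.rpow_left_inj hXS.le (by positivity) hp.ne']
    constructor
    · intro h
      rw [div_eq_div_iff hS.ne' (by positivity)] at h
      exact mul_left_cancel₀ hX.ne' h
    · intro h
      rw [h]

lemma powerConst_self (hK : 1 ≤ K) (hγ : ∀ k, 0 < γ k) :
    powerConst a g γ ε γ = g 0 * ballVolume K ε *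
      ((1 + ε / K) / (a * alphaStar a g ^ 2 * g 0 * geomMean γ)) ^ ((K : ℝ) / ε) := by
  have hK' : (0 : ℝ) < K := by exact_mod_cast hK
  rw [powerConst, sum_geomMean_self hγ]
  congr 2
  rw [div_div, ← mul_assoc, mul_comm _ (K : ℝ), mul_assoc, ← div_div]
  congr 1
  field_simp

end PowerConst

/-! ### From the random effects model to labelled scores -/

section Model

variable {Ω : Type*} [MeasurableSpace Ω] {P : Measure Ω} [IsProbabilityMeasure P]
  {K : ℕ} {a : ℝ} {g : (Fin K → ℝ) → ℝ} {θ : ℕ → Ω → Fin 2} {ξ : ℕ → Ω → Fin K → ℝ}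

/-- The conditional law of the multivariate `p`-value given the label. -/
def labelLaw (g : (Fin K → ℝ) → ℝ) (c : Fin 2) : Measure (Fin K → ℝ) :=
  if c = 0 then uniformLaw K else lawOfDensity g

/-- The distribution of the label. -/
def labelProb (a : ℝ) (c : Fin 2) : ℝ := if c = 0 then 1 - a else a

namespace IsRandomEffectsModel

lemma measureReal_label (h : IsRandomEffectsModel P a g θ ξ) (ha0 : 0 < a) (i : ℕ) (c : Fin 2) :
    P.real {ω | θ i ω = c} = labelProb a c := by
  have h1 : P.real {ω | θ i ω = 1} = a := by
    rw [Measure.real, h.prob_false_null i, ENNReal.toReal_ofReal ha0.le]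
  revert c
  refine Fin.forall_fin_two.2 ⟨?_, h1⟩
  have h2 : {ω | θ i ω = 0} = {ω | θ i ω = 1}ᶜ := by
    ext ω
    have : ∀ x : Fin 2, x = 0 ↔ ¬ x = 1 := by decide
    exact this _
  have hm : MeasurableSet {ω | θ i ω = 1} := h.measurable_label i (measurableSet_singleton 1)
  rw [h2, probReal_compl_eq_one_sub hm, h1]
  rfl

lemma map_cond (h : IsRandomEffectsModel P a g θ ξ) (i : ℕ) (c : Fin 2) :
    (ProbabilityTheory.cond P {ω | θ i ω = c}).map (ξ i) = labelLaw g c := by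
  revert c
  exact Fin.forall_fin_two.2 ⟨h.law_true_null i, h.law_false_null i⟩

lemma measure_label_mem (h : IsRandomEffectsModel P a g θ ξ) (ha0 : 0 < a) (i : ℕ) (c : Fin 2)
    {B : Set (Fin K → ℝ)} (hB : MeasurableSet B) :
    P {ω | θ i ω = c ∧ ξ i ω ∈ B} = ENNReal.ofReal (labelProb a c) * labelLaw g c B := by
  have hm : MeasurableSet {ω | θ i ω = c} := h.measurable_label i (measurableSet_singleton c)
  rw [← h.map_cond i c, Measure.map_apply (h.measurable_pvalue i) hB,
    ← h.measureReal_label ha0 i c, ofReal_measureReal, mul_comm, cond_mul_eq_inter hm]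
  rfl

/-- The model prescribes only the label probabilities and the conditional laws. Slicing a set by the
label recovers the joint law from them, so it does not depend on `i`. -/
lemma identDistrib (h : IsRandomEffectsModel P a g θ ξ) (ha0 : 0 < a) (i : ℕ) :
    IdentDistrib (fun ω => (θ i ω, ξ i ω)) (fun ω => (θ 0 ω, ξ 0 ω)) P P where
  aemeasurable_fst := ((h.measurable_label i).prodMk (h.measurable_pvalue i)).aemeasurable
  aemeasurable_snd := ((h.measurable_label 0).prodMk (h.measurable_pvalue 0)).aemeasurable
  map_eq := by
    have key : ∀ j : ℕ, ∀ B : Set (Fin 2 × (Fin K → ℝ)), MeasurableSet B →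
        P.map (fun ω => (θ j ω, ξ j ω)) B =
          ∑ c : Fin 2, ENNReal.ofReal (labelProb a c) * labelLaw g c (Prod.mk c ⁻¹' B) := by
      intro j B hB
      have hmeas := (h.measurable_label j).prodMk (h.measurable_pvalue j)
      have hBc : ∀ c, MeasurableSet (Prod.mk c ⁻¹' B) := fun c => measurable_prodMk_left hB
      rw [Measure.map_apply hmeas hB]
      simp only [← h.measure_label_mem ha0 j _ (hBc _)]
      rw [← measure_biUnion_finset]
      · congr 1
        ext ω
        simp
      · intro c _ c' _ hcc'
        exact Set.disjoint_left.2 fun ω h1 h2 => hcc' (h1.1.symm.trans h2.1)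
      · intro c _
        exact (h.measurable_label j (measurableSet_singleton c)).inter
          (h.measurable_pvalue j (hBc c))
    ext B hB
    rw [key i B hB, key 0 B hB]

/-- The scores of the procedure based on the regions `Γ_u(ν)`. -/
lemma isScoreModel (h : IsRandomEffectsModel P a g θ ξ) (ha0 : 0 < a) (hK : 1 ≤ K)
    (hg : IsPeakedDensity g) {ν : Fin K → ℝ} (hν : ∀ k, 0 < ν k) {ε : ℝ} (hε : 0 < ε) :
    IsScoreModel P θ (fun i ω => regionVolume ν ε (weightedPow ν ε (ξ i ω)))
      (mixtureCdf a (scoreCdf g ν ε)) where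
  measurable_label := h.measurable_label
  measurable_score i := (measurable_score ν ε).comp (h.measurable_pvalue i)
  indep := h.indep.comp (fun _ x => (x.1, regionVolume ν ε (weightedPow ν ε x.2)))
    fun _ => measurable_fst.prodMk ((measurable_score ν ε).comp measurable_snd)
  ident i := (h.identDistrib ha0 i).comp
    (u := fun x : Fin 2 × (Fin K → ℝ) => (x.1, regionVolume ν ε (weightedPow ν ε x.2)))
    (measurable_fst.prodMk ((measurable_score ν ε).comp measurable_snd))
  score_mem i ω := regionVolume_mem ν ε _
  cdf i c t ht := by
    have hB : MeasurableSet {x : Fin K → ℝ | regionVolume ν ε (weightedPow ν ε x) ≤ t} :=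
      measurableSet_le (measurable_score ν ε) measurable_const
    have hinter : {x : Fin K → ℝ | regionVolume ν ε (weightedPow ν ε x) ≤ t} ∩ unitCube K =
        scoreSet ν ε t := by
      ext x
      exact and_comm
    have h1 := h.measure_label_mem ha0 i c hB
    have hp : 0 ≤ labelProb a c := by
      rw [← h.measureReal_label ha0 i c]; exact measureReal_nonneg
    have h2 : P.real {ω | θ i ω = c ∧ regionVolume ν ε (weightedPow ν ε (ξ i ω)) ≤ t} =
        labelProb a c *
          (labelLaw g c).real {x | regionVolume ν ε (weightedPow ν ε x) ≤ t} := by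
      have := congrArg ENNReal.toReal h1
      rwa [ENNReal.toReal_mul, ENNReal.toReal_ofReal hp] at this
    rw [h2]
    clear h1 h2 hp
    revert c
    refine Fin.forall_fin_two.2 ⟨?_, ?_⟩
    · have : (labelLaw g 0).real {x | regionVolume ν ε (weightedPow ν ε x) ≤ t} = t := by
        change (uniformLaw K).real _ = t
        rw [uniformLaw, measureReal_restrict_apply hB, hinter, volume_scoreSet hK hε hν ht]
      rw [this]
      rfl
    · have : (labelLaw g 1).real {x | regionVolume ν ε (weightedPow ν ε x) ≤ t} =
          scoreCdf g ν ε t := by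
        change (lawOfDensity g).real _ = _
        rw [lawOfDensity, uniformLaw, Measure.real, withDensity_apply _ hB,
          Measure.restrict_restrict hB, hinter, scoreCdf,
          integral_eq_lintegral_of_nonneg_ae]
        · filter_upwards [ae_restrict_mem (measurableSet_scoreSet ν ε t)] with z hz
          exact hg.nonneg z hz.1
        · exact (hg.integrableOn.mono_set (scoreSet_subset ν ε t)).aestronglyMeasurable
      rw [this]
      rfl

end IsRandomEffectsModel

end Model

end EllipsoidFDR

end

/-! ### Assembly -/

open EllipsoidFDR in
theorem proposition4p1 {Ω : Type*} [MeasurableSpace Ω] (P : Measure Ω) [IsProbabilityMeasure P]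
    {K : ℕ} (hK : 1 ≤ K) {a : ℝ} (ha0 : 0 < a) (ha1 : a < 1)
    {g : (Fin K → ℝ) → ℝ} (hg : IsPeakedDensity g)
    {γ : Fin K → ℝ} (hγ : ∀ k, 0 < γ k) {ε : ℝ} (hε : 0 < ε) (hexp : HasExpansion g γ ε)
    (θ : ℕ → Ω → Fin 2) (ξ : ℕ → Ω → Fin K → ℝ) (hmodel : IsRandomEffectsModel P a g θ ξ) :
    (∀ ν : Fin K → ℝ, (∀ k, 0 < ν k) →
      IsMinAttainablePFDR P θ (ellipsoidReject ξ ν ε) ((1 - a) * alphaStar a g) ∧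
      (∀ α ∈ Set.Ioo (alphaStar a g) 1,
        Tendsto (fun n => pFDR P θ (ellipsoidReject ξ ν ε α n)) atTop (𝓝 ((1 - a) * α))) ∧
      (∀ᶠ α in 𝓝[>] (alphaStar a g),
        Tendsto (fun n => power P θ (ellipsoidReject ξ ν ε α n)) atTop
          (𝓝 (limitPower P θ ξ ν ε α))) ∧
      (fun α => limitPower P θ ξ ν ε α) ~[𝓝[>] (alphaStar a g)]
        (fun α => powerConst a g γ ε ν * (α - alphaStar a g) ^ ((K : ℝ) / ε))) ∧
    (∀ ν : Fin K → ℝ, (∀ k, 0 < ν k) →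
      powerConst a g γ ε ν ≤ powerConst a g γ ε γ ∧
      (powerConst a g γ ε ν = powerConst a g γ ε γ ↔ ∃ c : ℝ, 0 < c ∧ ν = c • γ)) ∧
    powerConst a g γ ε γ = g 0 * ballVolume K ε *
      ((1 + ε / K) / (a * alphaStar a g ^ 2 * g 0 * geomMean γ)) ^ ((K : ℝ) / ε) := by

  have hκ : alphaStar a g = criticalLevel a (g 0) := rfl
  have hg0 := hg.zero_pos
  have hd : 0 < ε / K := div_pos hε (by exact_mod_cast hK)
  -- A fact about `g` alone, obtained from the score with weights `γ`; any positive weights would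
  -- do.
  have hb : 1 < g 0 := (hg.isPeakedCdf hK hε hγ hd
    (hasDeficitRate_scoreCdf hK hε hg hγ hγ hexp)).one_lt
  have hκ0 : 0 < alphaStar a g := criticalLevel_pos ha0 hb
  have hκ1 : alphaStar a g < 1 := criticalLevel_lt_one ha0 hb
  refine ⟨fun ν hν => ?_, fun ν hν => powerConst_le hK hε hg0 ha0 hκ0 hγ hν,
    powerConst_self hK hγ⟩
  have hrate := hasDeficitRate_scoreCdf hK hε hg hγ hν hexp
  have hL := deficitConst_pos hK hε hg hγ hν
  have hF := hg.isPeakedCdf hK hε hν hd hrate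
  have hM := hmodel.isScoreModel ha0 hK hg hν hε
  obtain ⟨ρ, hρ, hasym⟩ := hM.exists_limitPower hF ha0 ha1 hrate hd hL
  -- `limUnder` is meaningful only where the limit exists, so the identification with `ρ` holds only
  -- near the critical level.
  have hlim : ∀ᶠ α in 𝓝[>] (alphaStar a g), limitPower P θ ξ ν ε α = ρ α :=
    hρ.mono fun α hα => hα.limUnder_eq
  -- The minimum is attained at the critical level `α_*` itself.
  refine ⟨⟨fun α hα n hn => hM.le_pFDR hF ha0 ha1 hα hn,
    alphaStar a g, ⟨hκ0, hκ1⟩, hM.tendsto_pFDR_criticalLevel hF ha0 ha1⟩,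
    fun α hα => hM.tendsto_pFDR hF ha0 ha1 hα, ?_, ?_⟩
  · filter_upwards [hρ, hlim] with α h1 h2
    rw [h2]
    exact h1
  · have hC := powerConst_pos hK hε hg0 ha0 hκ0 hγ hν
    have hconst := powerConst_eq_deficitConst hK ha0 hε hg0 hγ hν hκ (hκ ▸ hκ0)
    rw [← hκ] at hasym hconst
    rw [← hconst, one_div_div] at hasym
    refine isEquivalent_of_tendsto_one ?_
    have h1 := hasym.div_const (powerConst a g γ ε ν)
    rw [div_self hC.ne'] at h1
    refine h1.congr' ?_
    filter_upwards [hlim] with α hα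
    rw [Pi.div_apply, hα, div_div, mul_comm]
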